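/- Let $p=p(n)\in[0,1]$ satisfy $np\to\infty$, $$p \gg \frac{(\log n)^2(\log (np))^2}{n}\qquad\text{and}\qquad p\le 1-\varepsilon$$ for all sufficiently large $n$, for some fixed $\varepsilon\in(0,1)$. Here $f\gg g$ means $g=o(f)$ as $n\to\infty$, $\log$ is the natural logarithm and $\lg$ is the logarithm to base $2$. Let $G(n,p)$ be the binomial random graph on $n$ labelled vertices. For a graph $G=(V,E)$, the set chromatic number $\chi_s(G)$ is the least $k$ for which there is a (not necessarily proper) colouring $c:V\to\{1,\dots,k\}$ such that $C(u)\ne C(v)$ for every edge $uv\in E$, where $C(v)=\{c(w): vw\in E\}$. Put $$s=s(p)=\min\big\{[(1-p)^\ell]^2+[1-(1-p)^\ell]^2:\ \ell\in\mathbb N\big\}.$$ (i) If $p=o(1)$, define $r=r(n)$ (for all large $n$) by $(np)^2 s^{\,r\lg n}=(\log^2 n)(\log^2(np))$, that is, $$r=\frac{-2\,(\lg(np)-\lg\log n-\lg\log(np))}{(\lg n)(\lg s)}.$$ Then $\Pr[\chi_s(G(n,p))\ge r\lg n]\to1$ as $n\to\infty$. (ii) If $p$ is constant, define $r$ by $n^2s^{\,r\lg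 n}=1$, that is, $r=2/\lg(1/s)$. Then there is a function $\eta(n)\to0$ such that $\Pr[\chi_s(G(n,p))\ge(1+\eta(n))\,r\lg n]\to1$ as $n\to\infty$. -/

import Mathlib

open Filter Topology Asymptotics

namespace SetColouring

/-- The neighbourhood colour set `C(v) = {c(u) : uv ∈ E}` of the vertex `v`. -/
def nbrColours {V α : Type*} (G : SimpleGraph V) (c : V → α) (v : V) : Set α :=
  c '' G.neighborSet v

/-- A (not necessarily proper) colouring `c` is a set colouring if adjacent vertices have
distinct neighbourhood colour sets. -/
def IsSetColouring {V α : Type*} (G : SimpleGraph V) (c : V → α) : Prop :=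
  ∀ u v : V, G.Adj u v → nbrColours G c u ≠ nbrColours G c v

/-- The set chromatic number `χ_s(G)`: the least `k` such that `G` has a set colouring with
colours from a set of size `k`. -/
noncomputable def setChromaticNumber {V : Type*} (G : SimpleGraph V) : ℕ :=
  sInf {k : ℕ | ∃ c : V → Fin k, IsSetColouring G c}

/-- On a finite vertex set some set colouring exists (give all vertices different colours), so
the minimum in the definition of `χ_s` is attained. -/
theorem exists_isSetColouring_setChromaticNumber {n : ℕ} (G : SimpleGraph (Fin n)) :
    ∃ c : Fin n → Fin (setChromaticNumber G), IsSetColouring G c := by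
  have h : {k : ℕ | ∃ c : Fin n → Fin k, IsSetColouring G c}.Nonempty := by
    refine ⟨n, id, fun u v huv h => ?_⟩
    have hv : v ∈ nbrColours G id u := ⟨v, huv, rfl⟩
    rw [h] at hv
    obtain ⟨w, hw, hwv⟩ := hv
    have hw' : G.Adj v w := hw
    have hwv' : w = v := hwv
    rw [hwv'] at hw'
    exact G.loopless.irrefl v hw'
  exact Nat.sInf_mem h

/-- `[(1-p)^ℓ]² + [1-(1-p)^ℓ]²`. -/
noncomputable def sVal (p : ℝ) (l : ℕ) : ℝ :=
  ((1 - p) ^ l) ^ 2 + (1 - (1 - p) ^ l) ^ 2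

/-- `s(p) = min { [(1-p)^ℓ]² + [1-(1-p)^ℓ]² : ℓ ∈ ℕ }`. -/
noncomputable def s (p : ℝ) : ℝ := ⨅ l : ℕ, sVal p l

/-- The infimum defining `s(p)` is a minimum. -/
theorem exists_sVal_eq_s {p : ℝ} (h0 : 0 < p) (h1 : p < 1) :
    ∃ l : ℕ, s p = sVal p l ∧ ∀ m : ℕ, sVal p l ≤ sVal p m := by
  have hlt : sVal p 1 < 1 := by
    unfold sVal
    nlinarith
  have hpow : Tendsto (fun l : ℕ => (1 - p) ^ l) atTop (𝓝 0) :=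
    tendsto_pow_atTop_nhds_zero_of_lt_one (by linarith) (by linarith)
  have hlim : Tendsto (sVal p) atTop (𝓝 1) := by
    have := (hpow.pow 2).add ((hpow.const_sub 1).pow 2)
    norm_num at this
    exact this
  obtain ⟨N, hN⟩ := eventually_atTop.1 (hlim.eventually (lt_mem_nhds hlt))
  obtain ⟨l, -, hl⟩ := Finset.exists_min_image (Finset.range (N + 2)) (sVal p) ⟨1, by simp⟩
  have hmin : ∀ m : ℕ, sVal p l ≤ sVal p m := by
    intro m
    by_cases hm : m < N + 2
    · exact hl m (by simpa using hm)
    · exact (hl 1 (by simp)).trans (hN m (by omega)).le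
  refine ⟨l, le_antisymm (ciInf_le ⟨sVal p l, ?_⟩ l) (le_ciInf hmin), hmin⟩
  rintro _ ⟨m, rfl⟩
  exact hmin m

/-- `r(p) = 2 / lg(1/s)` for a constant `p`; that is, `n² s^{r lg n} = 1`. -/
noncomputable def rConst (p : ℝ) : ℝ := 2 / Real.logb 2 (1 / s p)

/-- `r = r(p)` for `p = p(n) = o(1)`, in explicit form:
`r = -2 (lg(np) - lg log n - lg log(np)) / ((lg n) (lg s))`. -/
noncomputable def rSparse (n : ℕ) (p : ℝ) : ℝ :=
  -2 * (Real.logb 2 (n * p) - Real.logb 2 (Real.log n) - Real.logb 2 (Real.log (n * p))) /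
    (Real.logb 2 n * Real.logb 2 (s p))

/-- `r = rSparse n p` is characterized by `(np)² s^{r lg n} = (log² n)(log² (np))`. -/
theorem rSparse_spec {n : ℕ} {p : ℝ} (hn : 2 ≤ n) (hnp : 1 < n * p)
    (hs0 : 0 < s p) (hs1 : s p < 1) (r : ℝ) :
    (n * p) ^ 2 * s p ^ (r * Real.logb 2 n) = Real.log n ^ 2 * Real.log (n * p) ^ 2 ↔
      r = rSparse n p := by
  have hn1 : (1 : ℝ) < n := by exact_mod_cast hn
  have hln : 0 < Real.log n := Real.log_pos hn1
  have hlnp : 0 < Real.log (n * p) := Real.log_pos hnp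
  have hx : (0 : ℝ) < n * p := by linarith
  have hls : Real.log (s p) < 0 := Real.log_neg hs0 hs1
  have h2 : 0 < Real.log 2 := Real.log_pos (by norm_num)
  have hpow : 0 < s p ^ (r * Real.logb 2 n) := Real.rpow_pos_of_pos hs0 _
  rw [← Real.log_injOn_pos.eq_iff (Set.mem_Ioi.2 (by positivity)) (Set.mem_Ioi.2 (by positivity)),
    Real.log_mul (by positivity) hpow.ne', Real.log_mul (by positivity) (by positivity),
    Real.log_rpow hs0, Real.log_pow, Real.log_pow, Real.log_pow, rSparse]
  simp only [Real.logb]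
  have hls' := hls.ne
  rw [eq_div_iff (by positivity)]
  field_simp
  push_cast
  constructor <;> intro h <;> linarith

/-- The property `P n G` holds asymptotically almost surely for the binomial random graph
`G = 𝔾(n, p(n))` on the vertex set `Fin n`: its probability tends to `1` as `n → ∞`. -/
def AAS (p : ℕ → unitInterval) (P : (n : ℕ) → SimpleGraph (Fin n) → Prop) : Prop :=
  Tendsto (fun n : ℕ => SimpleGraph.binomialRandom (Fin n) (p n) {G | P n G}) atTop (𝓝 1)

end SetColouring

/-!
A colouring of `G(n, p)` with `k` colours is coded by few vertices. Let `m` be about `3 log n / p`.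
With high probability any two disjoint sets of `m` vertices are joined by an edge, so all but `2 m`
vertices have a neighbour in a given colour class of size at least `m`. Outside a set `X` of at most
`3 k m` vertices, which contains the classes `S i` of size less than `m`, the neighbourhood colour
set of a vertex is therefore determined by its *type*, the set of those `i` for which it has a
neighbour in `S i`, and a set colouring forces vertices of equal type outside `X` to be
non-adjacent (`exists_small_classes`). There are at most `(n + 1) ^ (4 k m)` choices of the classes
`S i` and of `X`, and a union bound over them suffices (`binomialRandom_isSetColouring_le`).

For fixed `S` and `X` the types of the remaining vertices are independent with a product law `π` on
the `2 ^ k` subsets of `Fin k`, and they are independent of the edges among these vertices. Split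
off two groups of `N ≈ n / 4` vertices. The probability that no edge between the groups joins two
vertices of equal type is at most `(N + 1) exp (-a N / 4)`, where
`a = ∑ π_T min(1, p N π_T)` (`sum_prod_mul_pow_le`, `binomialRandom_no_equal_seen_le`). The vertices
of the first group are exposed one at a time: as long as the rate that remains is at least `a / 2`,
each vertex lowers the expected survival probability by the factor `1 - a / 4`, and once the rate
has dropped below `a / 2`, the types already exposed exclude so much that the second group survives
with probability at most `exp (-a N / 2)`.

It remains to bound `a` from below. The collision probability `q = ∑ π_T ^ 2` is at least `s ^ k`,
because each colour contributes a factor `[(1-p)^ℓ]² + [1-(1-p)^ℓ]²`. In general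
`a ≥ min (p N q) (√q)` (`min_mul_sqrt_le_collisionRate`). For constant `p`, where `(1 + η) r lg n`
leaves room for a power of `log n`, this is enough. For `p = o(1)` and `L = log n · log (n p)`, the
definition of `r` gives `s ^ k ≥ (L / (n p)) ^ 2`, and `a N` has to be of order `L ^ 2 / p`. If
`p ≤ n ^ (-1/2)`, then `s` is so close to `1 / 2` that counting the `2 ^ k` types suffices
(`half_min_le_collisionRate`). If `p` is larger and `√q ≥ L ^ 2 / (n p)`, the general bound
suffices. Otherwise `q` is close to its minimum, no type is likely enough for the truncation in `a`
to matter much, and `a ≥ p N q / 2`; here the product structure enters through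
`∑ π_T ^ 3 ≤ 2 ^ k q ^ 3` (`sum_subsetLaw_cube_le`).
-/

namespace SetColouring

/-! ### Independent types and the probability of avoiding equal types -/

theorem exp_neg_le_one_sub_half_min {x : ℝ} (hx : 0 ≤ x) : Real.exp (-x) ≤ 1 - min 1 x / 2 := by
  rcases le_total x 1 with h | h
  · rw [min_eq_right h]
    have h1 : 1 + x ≤ Real.exp x := by linarith [Real.add_one_le_exp x]
    rw [Real.exp_neg, inv_le_comm₀ (Real.exp_pos x) (by linarith)]
    refine le_trans ?_ h1
    rw [inv_le_iff_one_le_mul₀ (by linarith)]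
    nlinarith
  · rw [min_eq_left h]
    have h1 : (2 : ℝ) ≤ Real.exp x := by linarith [Real.add_one_le_exp x]
    rw [Real.exp_neg, inv_le_comm₀ (Real.exp_pos x) (by norm_num)]
    norm_num
    exact h1

theorem min_one_sub_min_one_mul_le {y θ : ℝ} (h0 : 0 ≤ θ) (h1 : θ ≤ 1) :
    min 1 y - min 1 (y * θ) ≤ 1 - θ := by
  rcases le_total 1 y with h | h <;> rcases le_total 1 (y * θ) with h' | h' <;>
    simp only [min_eq_left, min_eq_right, h, h'] <;> nlinarith

section Core

variable {ι : Type*} [Fintype ι] [DecidableEq ι]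

/-- `∑ᵢ πᵢ min(1, b πᵢ)`: the truncated collision rate of a probability vector `π`. -/
noncomputable def collisionRate {ι : Type*} [Fintype ι] (π : ι → ℝ) (b : ℝ) : ℝ :=
  ∑ i, π i * min 1 (b * π i)

/-- `N` times the probability that a further vertex, of random type, is adjacent to an earlier
vertex of its type when there are already `X i` vertices of type `i`. -/
noncomputable def exposure (π : ι → ℝ) (p : ℝ) (N : ℕ) (X : ι → ℕ) : ℝ :=
  N * ∑ i, π i * (1 - (1 - p) ^ X i)

theorem exposure_add_single (π : ι → ℝ) (p : ℝ) (N : ℕ) (X : ι → ℕ) (j : ι) :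
    exposure π p N (X + Pi.single j 1) = exposure π p N X + N * (π j * (p * (1 - p) ^ X j)) := by
  rw [exposure, exposure, ← mul_add, ← Finset.add_sum_erase _ _ (Finset.mem_univ j),
    ← Finset.add_sum_erase (a := j) (s := Finset.univ) (fun i => π i * (1 - (1 - p) ^ X i))
      (Finset.mem_univ j)]
  have : ∑ i ∈ Finset.univ.erase j, π i * (1 - (1 - p) ^ (X + Pi.single j 1 : ι → ℕ) i) =
      ∑ i ∈ Finset.univ.erase j, π i * (1 - (1 - p) ^ X i) := by
    refine Finset.sum_congr rfl fun i hi => ?_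
    simp [Pi.single_eq_of_ne (Finset.ne_of_mem_erase hi)]
  rw [this]
  simp only [Pi.add_apply, Pi.single_eq_same, pow_succ]
  ring

/-- A bound on the expectation of `exp (-exposure)` after `t` further vertices of independent
random types. -/
theorem sum_exp_neg_exposure_le {π : ι → ℝ} (hπ : ∀ i, 0 ≤ π i) (hπ1 : ∑ i, π i = 1) {p : ℝ}
    (hp0 : 0 ≤ p) (hp1 : p ≤ 1) (N t : ℕ) (X : ι → ℕ) :
    ∑ τ : Fin t → ι, (∏ u, π (τ u)) *
        Real.exp (-exposure π p N (X + ∑ u, Pi.single (τ u) 1)) ≤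
      Real.exp (-exposure π p N X) * (1 - collisionRate π (p * N) / 4) ^ t +
        t * Real.exp (-(N * collisionRate π (p * N) / 2)) := by
  set a := collisionRate π (p * N) with ha
  have hq0 : 0 ≤ 1 - p := by linarith
  have hq1 : 1 - p ≤ 1 := by linarith
  have hb : ∀ i, 0 ≤ p * N * π i := fun i => mul_nonneg (by positivity) (hπ i)
  have ha1 : a ≤ 1 := by
    rw [← hπ1]
    exact Finset.sum_le_sum fun i _ => mul_le_of_le_one_right (hπ i) (min_le_left _ _)
  induction t generalizing X with
  | zero => simp
  | succ t ih =>
    rw [← (Fin.consEquiv fun _ : Fin (t + 1) => ι).sum_comp, Fintype.sum_prod_type]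
    have step : ∀ i, ∑ τ : Fin t → ι, (∏ u, π ((Fin.consEquiv fun _ : Fin (t + 1) => ι) (i, τ) u)) *
        Real.exp (-exposure π p N (X + ∑ u, Pi.single
          ((Fin.consEquiv fun _ : Fin (t + 1) => ι) (i, τ) u) 1)) ≤
        π i * (Real.exp (-exposure π p N (X + Pi.single i 1)) * (1 - a / 4) ^ t +
          t * Real.exp (-(N * a / 2))) := by
      intro i
      refine le_trans (le_of_eq ?_) (mul_le_mul_of_nonneg_left (ih (X + Pi.single i 1)) (hπ i))
      rw [Finset.mul_sum]
      refine Finset.sum_congr rfl fun τ _ => ?_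
      simp only [Fin.consEquiv_apply, Fin.prod_univ_succ, Fin.sum_univ_succ, Fin.cons_zero,
        Fin.cons_succ, add_assoc, mul_assoc]
    refine (Finset.sum_le_sum fun i _ => step i).trans ?_
    have split : ∑ i, π i * (Real.exp (-exposure π p N (X + Pi.single i 1)) * (1 - a / 4) ^ t +
          t * Real.exp (-(N * a / 2))) =
        (∑ i, π i * Real.exp (-exposure π p N (X + Pi.single i 1))) * (1 - a / 4) ^ t +
          t * Real.exp (-(N * a / 2)) := by
      simp only [mul_add, Finset.sum_add_distrib, ← Finset.sum_mul, hπ1, one_mul, ← mul_assoc]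
    rw [split]
    have key : ∑ i, π i * Real.exp (-exposure π p N (X + Pi.single i 1)) ≤
        Real.exp (-exposure π p N X) * (1 - a / 4) + Real.exp (-(N * a / 2)) := by
      -- `A` is the collision rate that remains after the vertices counted by `X`.
      set A := ∑ i, π i * min 1 (p * N * π i * (1 - p) ^ X i) with hA
      have hstep : ∑ i, π i * Real.exp (-exposure π p N (X + Pi.single i 1)) ≤
          Real.exp (-exposure π p N X) * (1 - A / 2) := by
        have : 1 - A / 2 = ∑ i, π i * (1 - min 1 (p * N * π i * (1 - p) ^ X i) / 2) := by
          simp only [mul_sub, mul_one, Finset.sum_sub_distrib, hπ1, hA, Finset.sum_div, mul_div_assoc]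
        rw [this, Finset.mul_sum]
        refine Finset.sum_le_sum fun i _ => ?_
        rw [exposure_add_single, neg_add, Real.exp_add, mul_left_comm]
        refine mul_le_mul_of_nonneg_left (mul_le_mul_of_nonneg_left ?_ (hπ i)) (Real.exp_pos _).le
        have := exp_neg_le_one_sub_half_min (mul_nonneg (hb i) (pow_nonneg hq0 (X i)))
        refine le_trans (le_of_eq ?_) this
        congr 2
        ring
      rcases le_total (a / 2) A with h | h
      · refine hstep.trans ?_
        have : Real.exp (-exposure π p N X) * (1 - A / 2) ≤
            Real.exp (-exposure π p N X) * (1 - a / 4) :=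
          mul_le_mul_of_nonneg_left (by linarith) (Real.exp_pos _).le
        linarith [Real.exp_pos (-(N * a / 2))]
      · -- The rate lost by exposing `X` is at most `exposure π p N X / N`.
        have hA0 : 0 ≤ A := Finset.sum_nonneg fun i _ => mul_nonneg (hπ i)
          (le_min zero_le_one (mul_nonneg (hb i) (pow_nonneg hq0 _)))
        have hloss : a - A ≤ ∑ i, π i * (1 - (1 - p) ^ X i) := by
          rw [ha, hA, collisionRate, ← Finset.sum_sub_distrib]
          refine Finset.sum_le_sum fun i _ => ?_
          rw [← mul_sub]
          exact mul_le_mul_of_nonneg_left (min_one_sub_min_one_mul_le (pow_nonneg hq0 _)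
            (pow_le_one₀ hq0 hq1)) (hπ i)
        have hexp : Real.exp (-exposure π p N X) ≤ Real.exp (-(N * a / 2)) := by
          rw [Real.exp_le_exp, neg_le_neg_iff, exposure, mul_div_assoc]
          exact mul_le_mul_of_nonneg_left (by linarith) (Nat.cast_nonneg N)
        have h1 : Real.exp (-exposure π p N X) * (1 - A / 2) ≤ Real.exp (-exposure π p N X) :=
          mul_le_of_le_one_right (Real.exp_pos _).le (by linarith)
        have h2 : 0 ≤ Real.exp (-exposure π p N X) * (1 - a / 4) :=
          mul_nonneg (Real.exp_pos _).le (by linarith)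
        linarith
    have ha0 : 0 ≤ a := Finset.sum_nonneg fun i _ => mul_nonneg (hπ i)
      (le_min zero_le_one (hb i))
    have hr0 : 0 ≤ (1 - a / 4) ^ t := pow_nonneg (by linarith) _
    have hr1 : (1 - a / 4) ^ t ≤ 1 := pow_le_one₀ (by linarith) (by linarith)
    have h3 := mul_le_mul_of_nonneg_right key hr0
    have h4 : Real.exp (-(N * a / 2)) * (1 - a / 4) ^ t ≤ Real.exp (-(N * a / 2)) :=
      mul_le_of_le_one_right (Real.exp_pos _).le hr1
    push_cast
    rw [pow_succ]
    nlinarith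

/-- If `N` vertices and `N` further vertices receive independent types of law `π`, and each pair
of vertices of equal type from the two groups is then joined with probability `p`, the probability
that no such pair is joined is at most `(N + 1) exp (-a N / 4)`, where `a` is the collision
rate. -/
theorem sum_prod_mul_pow_le {U : Type*} [Fintype U] [DecidableEq U] {π : ι → ℝ} (hπ : ∀ i, 0 ≤ π i)
    (hπ1 : ∑ i, π i = 1) {p : ℝ} (hp0 : 0 ≤ p) (hp1 : p ≤ 1) {N : ℕ} (hU : Fintype.card U = N) :
    ∑ τ : U → ι, (∏ u, π (τ u)) *
        (∑ i, π i * (1 - p) ^ (Finset.univ.filter fun u => τ u = i).card) ^ N ≤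
      (N + 1) * Real.exp (-(N * collisionRate π (p * N) / 4)) := by
  set a := collisionRate π (p * N) with ha
  have hq0 : 0 ≤ 1 - p := by linarith
  have ha0 : 0 ≤ a := Finset.sum_nonneg fun i _ => mul_nonneg (hπ i)
    (le_min zero_le_one (mul_nonneg (by positivity) (hπ i)))
  have ha1 : a ≤ 1 := by
    rw [← hπ1]
    exact Finset.sum_le_sum fun i _ => mul_le_of_le_one_right (hπ i) (min_le_left _ _)
  have hmain := sum_exp_neg_exposure_le hπ hπ1 hp0 hp1 N N 0
  rw [← ha] at hmain
  have e : U ≃ Fin N := Fintype.equivFinOfCardEq hU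
  have h1 : ∑ τ : U → ι, (∏ u, π (τ u)) *
        (∑ i, π i * (1 - p) ^ (Finset.univ.filter fun u => τ u = i).card) ^ N ≤
      ∑ τ : Fin N → ι, (∏ u, π (τ u)) *
        Real.exp (-exposure π p N (0 + ∑ u, Pi.single (τ u) 1)) := by
    rw [← (e.arrowCongr (Equiv.refl ι)).sum_comp]
    refine Finset.sum_le_sum fun τ _ => ?_
    have hprod : ∏ u, π ((e.arrowCongr (Equiv.refl ι)) τ u) = ∏ u, π (τ u) := by
      rw [← e.prod_comp]
      simp
    rw [hprod]
    refine mul_le_mul_of_nonneg_left ?_ (Finset.prod_nonneg fun u _ => hπ _)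
    have hcount : ∀ i, (0 + ∑ u, Pi.single ((e.arrowCongr (Equiv.refl ι)) τ u) 1 : ι → ℕ) i =
        (Finset.univ.filter fun u => τ u = i).card := by
      intro i
      rw [zero_add, Finset.sum_apply, ← e.sum_comp, Finset.card_filter]
      refine Finset.sum_congr rfl fun u _ => ?_
      simp [Pi.single_apply, eq_comm]
    simp only [exposure, hcount]
    rw [← mul_neg, Real.exp_nat_mul]
    refine pow_le_pow_left₀ (Finset.sum_nonneg fun i _ => mul_nonneg (hπ i) (pow_nonneg hq0 _)) ?_ N
    have : ∑ i, π i * (1 - p) ^ (Finset.univ.filter fun u => τ u = i).card =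
        -(∑ i, π i * (1 - (1 - p) ^ (Finset.univ.filter fun u => τ u = i).card)) + 1 := by
      simp only [mul_sub, mul_one, Finset.sum_sub_distrib, hπ1]
      ring
    rw [this]
    exact Real.add_one_le_exp _
  refine (h1.trans hmain).trans ?_
  have h2 : (1 - a / 4) ^ N ≤ Real.exp (-(N * a / 4)) := by
    have : Real.exp (-(N * a / 4)) = Real.exp (-(a / 4)) ^ N := by
      rw [← Real.exp_nat_mul]
      congr 1
      ring
    rw [this]
    exact pow_le_pow_left₀ (by linarith) (by linarith [Real.add_one_le_exp (-(a / 4))]) N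
  have h3 : Real.exp (-(N * a / 2)) ≤ Real.exp (-(N * a / 4)) := by
    rw [Real.exp_le_exp]
    have : 0 ≤ N * a := by positivity
    linarith
  have h4 : Real.exp (-exposure π p N 0) = 1 := by simp [exposure]
  rw [h4]
  nlinarith [mul_le_mul_of_nonneg_left h3 (Nat.cast_nonneg (α := ℝ) N)]

end Core

/-! ### Lower bounds on the collision rate -/

section RateBounds

variable {ι : Type*} [Fintype ι] {π : ι → ℝ}

theorem half_min_le_collisionRate (hπ : ∀ i, 0 ≤ π i) (hπ1 : ∑ i, π i = 1) {b : ℝ} (hb : 0 ≤ b) :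
    1 / 2 * min 1 (b / (2 * Fintype.card ι)) ≤ collisionRate π b := by
  classical
  have hne : Nonempty ι := by
    by_contra h
    rw [not_nonempty_iff] at h
    simp at hπ1
  have hc : (0 : ℝ) < Fintype.card ι := by exact_mod_cast Fintype.card_pos
  set m : ℝ := min 1 (b / (2 * Fintype.card ι)) with hm
  have hm0 : 0 ≤ m := le_min zero_le_one (by positivity)
  -- Types of probability below `1 / (2 |ι|)` have total probability at most `1 / 2`.
  have hterm : ∀ i, π i * m - m / (2 * Fintype.card ι) ≤ π i * min 1 (b * π i) := by
    intro i
    rcases le_total (1 / (2 * Fintype.card ι : ℝ)) (π i) with h | h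
    · have h1 : m ≤ min 1 (b * π i) := by
        refine min_le_min_left 1 ?_
        rw [div_eq_mul_one_div]
        exact mul_le_mul_of_nonneg_left h hb
      have h2 : 0 ≤ m / (2 * Fintype.card ι) := by positivity
      linarith [mul_le_mul_of_nonneg_left h1 (hπ i)]
    · have h1 : 0 ≤ π i * min 1 (b * π i) :=
        mul_nonneg (hπ i) (le_min zero_le_one (mul_nonneg hb (hπ i)))
      have h2 := mul_le_mul_of_nonneg_right h hm0
      have h3 : 1 / (2 * Fintype.card ι : ℝ) * m = m / (2 * Fintype.card ι) := by ring
      linarith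
  have := Finset.sum_le_sum fun i (_ : i ∈ Finset.univ) => hterm i
  rw [Finset.sum_sub_distrib, ← Finset.sum_mul, hπ1, Finset.sum_const, Finset.card_univ,
    nsmul_eq_mul] at this
  have h5 : (Fintype.card ι : ℝ) * (m / (2 * Fintype.card ι)) = m / 2 := by field_simp
  rw [h5] at this
  refine le_trans ?_ this
  linarith

/-- Let `M` be the largest `πⱼ` and `q = ∑ π²`. If `b M ≤ 1`, no term is truncated; otherwise the
rate is at least `M` and at least `q / M`. -/
theorem min_mul_sqrt_le_collisionRate (hπ : ∀ i, 0 ≤ π i) (hπ1 : ∑ i, π i = 1) {b : ℝ}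
    (hb : 0 ≤ b) :
    min (b * ∑ i, π i ^ 2) √(∑ i, π i ^ 2) ≤ collisionRate π b := by
  have hne : Nonempty ι := by
    by_contra h
    rw [not_nonempty_iff] at h
    simp at hπ1
  obtain ⟨j, -, hj⟩ := Finset.exists_max_image Finset.univ π Finset.univ_nonempty
  have hnn : ∀ i, 0 ≤ π i * min 1 (b * π i) := fun i =>
    mul_nonneg (hπ i) (le_min zero_le_one (mul_nonneg hb (hπ i)))
  rcases le_total (b * π j) 1 with h | h
  · refine (min_le_left _ _).trans ?_
    rw [collisionRate, Finset.mul_sum]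
    refine Finset.sum_le_sum fun i hi => ?_
    rw [min_eq_right ((mul_le_mul_of_nonneg_left (hj i hi) hb).trans h)]
    exact le_of_eq (by ring)
  · refine (min_le_right _ _).trans ?_
    have hj0 : 0 < π j := by
      rcases (hπ j).lt_or_eq with h0 | h0
      · exact h0
      · rw [← h0, mul_zero] at h
        linarith
    have hb' : 1 / π j ≤ b := by rwa [div_le_iff₀ hj0]
    have h1 : π j ≤ collisionRate π b := by
      have := Finset.single_le_sum (fun i _ => hnn i) (Finset.mem_univ j)
      rwa [min_eq_left h, mul_one] at this
    have h2 : (∑ i, π i ^ 2) / π j ≤ collisionRate π b := by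
      rw [Finset.sum_div, collisionRate]
      refine Finset.sum_le_sum fun i hi => ?_
      rw [pow_two, mul_div_assoc]
      refine mul_le_mul_of_nonneg_left (le_min ?_ ?_) (hπ i)
      · exact (div_le_one hj0).2 (hj i hi)
      · rw [div_eq_mul_one_div, mul_comm]
        exact mul_le_mul_of_nonneg_right hb' (hπ i)
    rw [div_le_iff₀ hj0] at h2
    refine Real.sqrt_le_iff.2 ⟨hj0.le.trans h1, h2.trans ?_⟩
    nlinarith

/-- If `∑ π³` is small, the truncation costs at most half: `min(1, y) ≥ y - y² / 4`. -/
theorem half_mul_le_collisionRate (hπ : ∀ i, 0 ≤ π i) {b : ℝ}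
    (h : b ^ 2 * ∑ i, π i ^ 3 ≤ 2 * (b * ∑ i, π i ^ 2)) :
    b * (∑ i, π i ^ 2) / 2 ≤ collisionRate π b := by
  have hterm : ∀ i, b * π i ^ 2 - b ^ 2 * π i ^ 3 / 4 ≤ π i * min 1 (b * π i) := by
    intro i
    rcases le_total 1 (b * π i) with h | h
    · rw [min_eq_left h]
      nlinarith [mul_nonneg (hπ i) (sq_nonneg (b * π i - 2))]
    · rw [min_eq_right h]
      nlinarith [mul_nonneg (hπ i) (sq_nonneg (b * π i))]
  have := Finset.sum_le_sum fun i (_ : i ∈ Finset.univ) => hterm i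
  rw [Finset.sum_sub_distrib, ← Finset.mul_sum, ← Finset.sum_div, ← Finset.mul_sum] at this
  rw [collisionRate]
  linarith

end RateBounds

/-- The law of a random subset of `Fin k` that omits each `i` independently with probability
`x i`. -/
noncomputable def subsetLaw {k : ℕ} (x : Fin k → ℝ) (T : Finset (Fin k)) : ℝ :=
  ∏ i, if i ∈ T then 1 - x i else x i

theorem subsetLaw_nonneg {k : ℕ} {x : Fin k → ℝ} (h0 : ∀ i, 0 ≤ x i) (h1 : ∀ i, x i ≤ 1)
    (T : Finset (Fin k)) : 0 ≤ subsetLaw x T := by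
  refine Finset.prod_nonneg fun i _ => ?_
  split_ifs
  · linarith [h1 i]
  · exact h0 i

theorem sum_subsetLaw_pow {k : ℕ} (x : Fin k → ℝ) (j : ℕ) :
    ∑ T, subsetLaw x T ^ j = ∏ i, ((1 - x i) ^ j + x i ^ j) := by
  rw [Finset.prod_add, Finset.powerset_univ]
  refine Finset.sum_congr rfl fun T _ => ?_
  rw [subsetLaw, ← Finset.prod_pow, ← Finset.prod_mul_prod_compl T, Finset.compl_eq_univ_sdiff]
  congr 1
  · exact Finset.prod_congr rfl fun i hi => by simp [hi]
  · refine Finset.prod_congr rfl fun i hi => ?_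
    rw [if_neg (Finset.mem_sdiff.1 hi).2]

theorem sum_subsetLaw {k : ℕ} (x : Fin k → ℝ) : ∑ T, subsetLaw x T = 1 := by
  have := sum_subsetLaw_pow x 1
  simpa using this

/-- With `x = (1 + √e) / 2`, the factors satisfy `x² + (1 - x)² = (1 + e) / 2` and
`x³ + (1 - x)³ = (1 + 3 e) / 4`, and `1 + 3 e ≤ (1 + e) ^ 3`. -/
theorem sum_subsetLaw_cube_le {k : ℕ} {x : Fin k → ℝ} (h0 : ∀ i, 0 ≤ x i) (h1 : ∀ i, x i ≤ 1) :
    ∑ T, subsetLaw x T ^ 3 ≤ 2 ^ k * (∑ T, subsetLaw x T ^ 2) ^ 3 := by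
  have hc : (2 : ℝ) ^ k = ∏ _i : Fin k, 2 := by simp
  rw [sum_subsetLaw_pow, sum_subsetLaw_pow, ← Finset.prod_pow, hc, ← Finset.prod_mul_distrib]
  refine Finset.prod_le_prod (fun i _ => ?_) fun i _ => ?_
  · have := h0 i
    have : 0 ≤ 1 - x i := by linarith [h1 i]
    positivity
  · set e := (2 * x i - 1) ^ 2 with he
    have e0 : 0 ≤ e := sq_nonneg _
    have e2 : (1 - x i) ^ 2 + x i ^ 2 = (1 + e) / 2 := by rw [he]; ring
    have e3 : (1 - x i) ^ 3 + x i ^ 3 = (1 + 3 * e) / 4 := by rw [he]; ring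
    rw [e2, e3]
    nlinarith [mul_nonneg e0 e0, mul_nonneg (mul_nonneg e0 e0) e0]

theorem s_le_sVal (p : ℝ) (l : ℕ) : s p ≤ sVal p l :=
  ciInf_le ⟨0, by rintro _ ⟨m, rfl⟩; unfold sVal; positivity⟩ l

theorem half_le_sVal (p : ℝ) (l : ℕ) : 1 / 2 ≤ sVal p l := by
  unfold sVal
  nlinarith [sq_nonneg (2 * (1 - p) ^ l - 1)]

theorem half_le_s (p : ℝ) : 1 / 2 ≤ s p := le_ciInf (half_le_sVal p)

theorem s_pow_le_sum_subsetLaw_sq {k : ℕ} (p : ℝ) (l : Fin k → ℕ) :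
    s p ^ k ≤ ∑ T, subsetLaw (fun i => (1 - p) ^ l i) T ^ 2 := by
  have hc : s p ^ k = ∏ _i : Fin k, s p := by simp
  rw [sum_subsetLaw_pow, hc]
  refine Finset.prod_le_prod (fun i _ => by linarith [half_le_s p]) fun i _ => ?_
  exact (s_le_sVal p (l i)).trans (le_of_eq (by unfold sVal; ring))

/-- The powers `(1 - p) ^ l` decrease from `1` to `0` in steps of at most `p`, so one of them is
within `p` of `1 / 2`. -/
theorem s_le_half_add {p : ℝ} (hp0 : 0 < p) (hp1 : p ≤ 1 / 2) : s p ≤ 1 / 2 + 2 * p ^ 2 := by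
  have hex : ∃ l : ℕ, (1 - p) ^ l < 1 / 2 :=
    exists_pow_lt_of_lt_one (by norm_num) (by linarith)
  classical
  obtain ⟨l, hl⟩ : ∃ l, Nat.find hex = l + 1 := by
    refine Nat.exists_eq_succ_of_ne_zero fun h => ?_
    have := Nat.find_spec hex
    rw [h] at this
    norm_num at this
  have h1 : (1 - p) ^ (l + 1) < 1 / 2 := hl ▸ Nat.find_spec hex
  have h2 : 1 / 2 ≤ (1 - p) ^ l := not_lt.1 (Nat.find_min hex (by omega))
  have h3 : (1 - p) ^ l ≤ 1 := pow_le_one₀ (by linarith) (by linarith)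
  refine (s_le_sVal p l).trans ?_
  unfold sVal
  rw [pow_succ] at h1
  generalize (1 - p) ^ l = y at *
  have h4 : y - 1 / 2 ≤ p := by nlinarith
  nlinarith

/-! ### The union bound in the binomial random graph -/

section RandomGraph

open MeasureTheory ProbabilityTheory

theorem measurableSet_simpleGraph {V : Type*} [Finite V] (A : Set (SimpleGraph V)) :
    MeasurableSet A := by
  rw [← Set.preimage_image_eq A SimpleGraph.edgeSet_injective]
  exact SimpleGraph.measurable_edgeSet (Set.toFinite _).measurableSet

theorem binomialRandom_absent {V : Type*} [Finite V] (p : unitInterval) (F : Finset (Sym2 V))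
    (hF : ∀ e ∈ F, ¬ e.IsDiag) :
    (SimpleGraph.binomialRandom V p).real {G | ∀ e ∈ F, e ∉ G.edgeSet} =
      (1 - p : ℝ) ^ F.card := by
  classical
  rw [measureReal_def, SimpleGraph.binomialRandom_eq_map,
    Measure.map_apply SimpleGraph.measurable_fromEdgeSet (measurableSet_simpleGraph _),
    setBernoulli_apply']
  have hset : ((fun q : Sym2 V → Prop => {i | q i}) ⁻¹'
      (SimpleGraph.fromEdgeSet ⁻¹' {G | ∀ e ∈ F, e ∉ G.edgeSet})) =
      Set.pi (F : Set (Sym2 V)) fun _ => ({False} : Set Prop) := by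
    ext q
    simp only [Set.mem_preimage, Set.mem_ofPred_eq, SimpleGraph.edgeSet_fromEdgeSet, Set.mem_pi,
      Set.mem_singleton_iff, SetLike.mem_coe]
    refine forall₂_congr fun e he => ?_
    have := hF e he
    simp [this]
  rw [hset, Measure.infinitePi_pi _ (fun _ _ => MeasurableSet.of_discrete)]
  have hterm : ∀ e ∈ F, ((unitInterval.toNNReal p • Measure.dirac (e ∈ (Sym2.diagSetᶜ : Set (Sym2 V)))
      + unitInterval.toNNReal (unitInterval.symm p) • Measure.dirac False) ({False} : Set Prop)) =
      (unitInterval.toNNReal (unitInterval.symm p) : ENNReal) := by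
    intro e he
    have := hF e he
    simp [this]
  rw [Finset.prod_congr rfl hterm]
  simp

/-- In a binomial random graph, the events that the blocks of a family of disjoint sets of pairs
contain no edge are independent. -/
theorem binomialRandom_blocks {V : Type*} [Finite V] (p : unitInterval) {β : Type*}
    (b : β → Finset (Sym2 V)) (hb : ∀ j, ∀ e ∈ b j, ¬ e.IsDiag)
    (hd : Pairwise fun j j' => Disjoint (b j) (b j')) (σ : β → Prop) [DecidablePred σ]
    (T : Finset β) :
    (SimpleGraph.binomialRandom V p).real
        {G | ∀ j ∈ T, (∀ e ∈ b j, e ∉ G.edgeSet) ↔ σ j} =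
      ∏ j ∈ T, if σ j then (1 - p : ℝ) ^ (b j).card else 1 - (1 - p : ℝ) ^ (b j).card := by
  classical
  set μ := SimpleGraph.binomialRandom V p
  let f : β → Set (SimpleGraph V) := fun j => {G | ∀ e ∈ b j, e ∉ G.edgeSet}
  have hf : ∀ j, MeasurableSet (f j) := fun j => measurableSet_simpleGraph _
  have hμf : ∀ j, μ.real (f j) = (1 - p : ℝ) ^ (b j).card := fun j =>
    binomialRandom_absent p (b j) (hb j)
  have hind : iIndepSet f μ := by
    rw [iIndepSet_iff_meas_biInter hf]
    intro s
    rw [← ENNReal.toReal_eq_toReal_iff' (measure_ne_top _ _)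
      (ENNReal.prod_ne_top fun _ _ => measure_ne_top _ _), ENNReal.toReal_prod]
    have h1 : (⋂ i ∈ s, f i) = {G | ∀ e ∈ s.biUnion b, e ∉ G.edgeSet} := by
      ext G
      simp only [f, Set.mem_iInter, Set.mem_ofPred_eq, Finset.mem_biUnion]
      grind
    rw [h1]
    have h2 := binomialRandom_absent p (s.biUnion b) (by
      intro e he
      obtain ⟨j, -, hj⟩ := Finset.mem_biUnion.1 he
      exact hb j e hj)
    rw [Finset.card_biUnion (fun x _ y _ hxy => hd hxy), ← Finset.prod_pow_eq_pow_sum] at h2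
    exact h2.trans (Finset.prod_congr rfl fun j _ => (hμf j).symm)
  let g : β → Set (SimpleGraph V) := fun j => if σ j then f j else (f j)ᶜ
  have hset : {G : SimpleGraph V | ∀ j ∈ T, (∀ e ∈ b j, e ∉ G.edgeSet) ↔ σ j} = ⋂ j ∈ T, g j := by
    ext G
    simp only [Set.mem_iInter, Set.mem_ofPred_eq]
    refine forall₂_congr fun j _ => ?_
    by_cases h : σ j
    · simp only [g, h, if_true, iff_true]
      exact Iff.rfl
    · simp only [g, h, if_false, iff_false]
      exact Iff.rfl
  rw [hset, measureReal_def, ((iIndepSet_iff_iIndep _ _).1 hind).meas_biInter (S := T) (s := g),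
    ENNReal.toReal_prod]
  · refine Finset.prod_congr rfl fun j _ => ?_
    by_cases h : σ j
    · simp only [g, h, if_true]
      exact hμf j
    · simp only [g, h, if_false]
      rw [← measureReal_def, probReal_compl_eq_one_sub (hf j), hμf]
  · intro j _
    have hm := MeasurableSpace.measurableSet_generateFrom (Set.mem_singleton (f j))
    by_cases h : σ j
    · simpa only [g, h, if_true] using hm
    · simpa only [g, h, if_false] using hm.compl

variable {V : Type*} [Fintype V] [DecidableEq V]

open scoped Classical in
/-- The set of indices `i` such that `u` has a neighbour in `S i`. -/
noncomputable def seen {k : ℕ} (S : Fin k → Finset V) (G : SimpleGraph V) (u : V) :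
    Finset (Fin k) :=
  Finset.univ.filter fun i => ∃ w ∈ S i, G.Adj u w

/-- The pairs from a vertex to a set `S i` and the pairs between `U` and `W` are disjoint blocks.
Hence the sets `seen S G u` are independent of law `subsetLaw`, and independent of the edges between
`U` and `W`. -/
theorem binomialRandom_no_equal_seen_le {k : ℕ} (p : unitInterval) (S : Fin k → Finset V)
    (hS : Pairwise fun i j => Disjoint (S i) (S j)) {U W : Finset V} {N : ℕ}
    (hU : U.card = N) (hW : W.card = N) (hUW : Disjoint U W)
    (hSU : ∀ i, Disjoint (S i) U) (hSW : ∀ i, Disjoint (S i) W) :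
    (SimpleGraph.binomialRandom V p).real
        {G | ∀ u ∈ U, ∀ w ∈ W, seen S G u = seen S G w → ¬ G.Adj u w} ≤
      (N + 1) * Real.exp (-(N * collisionRate (subsetLaw fun i => (1 - p : ℝ) ^ (S i).card)
        (p * N) / 4)) := by
  classical
  set x : Fin k → ℝ := fun i => (1 - p : ℝ) ^ (S i).card with hx
  have hp0 : (0 : ℝ) ≤ p := p.2.1
  have hp1 : (p : ℝ) ≤ 1 := p.2.2
  have hx0 : ∀ i, 0 ≤ x i := fun i => pow_nonneg (by linarith) _
  have hx1 : ∀ i, x i ≤ 1 := fun i => pow_le_one₀ (by linarith) (by linarith)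
  set μ := SimpleGraph.binomialRandom V p
  -- The blocks: all pairs from `u` to `S i`, and the single pairs between `U` and `W`.
  let v : U ⊕ W → V := Sum.elim (fun u => u) (fun w => w)
  let b : (((U ⊕ W) × Fin k) ⊕ (U × W)) → Finset (Sym2 V) :=
    Sum.elim (fun a => (S a.2).image fun z => s(v a.1, z)) (fun a => {s((a.1 : V), (a.2 : V))})
  have hvS : ∀ a i, v a ∉ S i := by
    rintro (a | a) i h
    · exact Finset.disjoint_left.1 (hSU i) h a.2
    · exact Finset.disjoint_left.1 (hSW i) h a.2
  have hUW' : ∀ (a : U) (c : W), (a : V) ≠ c := fun a c h =>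
    Finset.disjoint_left.1 hUW a.2 (h ▸ c.2)
  have hvinj : Function.Injective v := by
    rintro (a | a) (c | c) h
    · exact congrArg _ (Subtype.ext h)
    · exact absurd h (hUW' a c)
    · exact absurd h.symm (hUW' c a)
    · exact congrArg _ (Subtype.ext h)
  have hb : ∀ j, ∀ e ∈ b j, ¬ e.IsDiag := by
    rintro (⟨a, i⟩ | ⟨a, c⟩) e he
    · obtain ⟨z, hz, rfl⟩ := Finset.mem_image.1 he
      rw [Sym2.mk_isDiag_iff]
      rintro rfl
      exact hvS a i hz
    · rw [Finset.mem_singleton.1 he, Sym2.mk_isDiag_iff]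
      exact hUW' a c
  have hd : Pairwise fun j j' => Disjoint (b j) (b j') := by
    intro j j' hjj
    rw [Finset.disjoint_left]
    intro e he he'
    apply hjj
    rcases j with ⟨a, i⟩ | ⟨a, c⟩ <;> rcases j' with ⟨a', i'⟩ | ⟨a', c'⟩
    · obtain ⟨z, hz, rfl⟩ := Finset.mem_image.1 he
      obtain ⟨z', hz', h⟩ := Finset.mem_image.1 he'
      rcases Sym2.eq_iff.1 h with ⟨h1, h2⟩ | ⟨h1, h2⟩
      · have := hvinj h1
        have hi : i' = i := by
          by_contra hne
          exact Finset.disjoint_left.1 (hS hne) hz' (h2 ▸ hz)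
        simp_all
      · exact absurd (h1 ▸ hz) (hvS a' i)
    · obtain ⟨z, hz, rfl⟩ := Finset.mem_image.1 he
      have h := Finset.mem_singleton.1 he'
      rcases Sym2.eq_iff.1 h with ⟨h1, h2⟩ | ⟨h1, h2⟩
      · exact absurd (by rwa [h2] at hz) (hvS (Sum.inr c') i)
      · exact absurd (by rwa [h2] at hz) (hvS (Sum.inl a') i)
    · obtain ⟨z, hz, rfl⟩ := Finset.mem_image.1 he'
      have h := Finset.mem_singleton.1 he
      rcases Sym2.eq_iff.1 h with ⟨h1, h2⟩ | ⟨h1, h2⟩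
      · exact absurd (by rwa [h2] at hz) (hvS (Sum.inr c) i')
      · exact absurd (by rwa [h2] at hz) (hvS (Sum.inl a) i')
    · have h := (Finset.mem_singleton.1 he).symm.trans (Finset.mem_singleton.1 he')
      rcases Sym2.eq_iff.1 h with ⟨h1, h2⟩ | ⟨h1, h2⟩
      · exact congrArg _ (Prod.ext (Subtype.ext h1) (Subtype.ext h2))
      · exact absurd h1 (hUW' a c')
  let ev : (U → Finset (Fin k)) → (W → Finset (Fin k)) → Set (SimpleGraph V) := fun s t =>
    {G | ∀ j ∈ (Finset.univ : Finset ((U ⊕ W) × Fin k)).disjSum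
        (Finset.univ.filter fun a : U × W => s a.1 = t a.2),
      (∀ e ∈ b j, e ∉ G.edgeSet) ↔
        Sum.elim (fun a : (U ⊕ W) × Fin k => a.2 ∉ Sum.elim s t a.1) (fun _ => True) j}
  have hcard : ∀ a : (U ⊕ W) × Fin k, (1 - p : ℝ) ^ (b (Sum.inl a)).card = x a.2 := by
    rintro ⟨a, i⟩
    simp only [b, Sum.elim_inl, hx]
    rw [Finset.card_image_of_injective]
    exact fun z z' h => Sym2.congr_right.1 h
  have hev : ∀ s t, μ.real (ev s t) = (∏ u, subsetLaw x (s u)) *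
      ∏ w, (subsetLaw x (t w) * (1 - p : ℝ) ^ (Finset.univ.filter fun u => s u = t w).card) := by
    intro s t
    rw [binomialRandom_blocks p b hb hd _ _, Finset.prod_disjSum, Finset.prod_mul_distrib,
      ← mul_assoc]
    congr 1
    · rw [Fintype.prod_prod_type, Fintype.prod_sum_type]
      simp only [hcard, Sum.elim_inl, Sum.elim_inr, subsetLaw, ite_not]
    · simp only [Sum.elim_inr, if_true, b, Finset.card_singleton, pow_one]
      rw [Finset.prod_filter, Fintype.prod_prod_type_right]
      refine Finset.prod_congr rfl fun w _ => ?_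
      rw [← Finset.prod_filter, Finset.prod_const]
  have hsub : {G : SimpleGraph V | ∀ u ∈ U, ∀ w ∈ W, seen S G u = seen S G w → ¬ G.Adj u w} ⊆
      ⋃ st ∈ (Finset.univ : Finset ((U → Finset (Fin k)) × (W → Finset (Fin k)))),
        ev st.1 st.2 := by
    intro G hG
    simp only [Set.mem_iUnion]
    refine ⟨(fun u => seen S G u, fun w => seen S G w), Finset.mem_univ _, ?_⟩
    intro j hj
    rcases j with ⟨a, i⟩ | ⟨u, w⟩
    · have : Sum.elim (fun u : U => seen S G u) (fun w : W => seen S G w) a = seen S G (v a) := by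
        rcases a with a | a <;> rfl
      change (∀ e ∈ (S i).image fun z => s(v a, z), e ∉ G.edgeSet) ↔
        i ∉ Sum.elim (fun u : U => seen S G u) (fun w : W => seen S G w) a
      rw [this]
      simp only [Finset.mem_image, seen, Finset.mem_filter, Finset.mem_univ, true_and, not_exists,
        not_and]
      constructor
      · intro h z hz
        simpa using h _ ⟨z, hz, rfl⟩
      · rintro h e ⟨z, hz, rfl⟩
        simpa using h z hz
    · simp only [Finset.inr_mem_disjSum, Finset.mem_filter, Finset.mem_univ, true_and] at hj
      simp only [Sum.elim_inr, iff_true, b, Finset.mem_singleton]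
      rintro e rfl
      simpa using hG u u.2 w w.2 hj
  have hN : Fintype.card W = N := by simpa using hW
  calc μ.real {G | ∀ u ∈ U, ∀ w ∈ W, seen S G u = seen S G w → ¬ G.Adj u w}
      ≤ _ := measureReal_mono hsub (measure_ne_top _ _)
    _ ≤ _ := measureReal_biUnion_finset_le _ _
    _ = ∑ s : U → Finset (Fin k), (∏ u, subsetLaw x (s u)) *
        (∑ T, subsetLaw x T * (1 - p : ℝ) ^ (Finset.univ.filter fun u => s u = T).card) ^ N := by
      rw [Fintype.sum_prod_type]
      refine Finset.sum_congr rfl fun s _ => ?_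
      simp only [hev]
      rw [← Finset.mul_sum]
      congr 1
      rw [← hN, ← Finset.card_univ, ← Finset.prod_const, Fintype.prod_sum]
    _ ≤ _ := sum_prod_mul_pow_le (subsetLaw_nonneg hx0 hx1) (sum_subsetLaw x) hp0 hp1
        (by simpa using hU)

/-- Any two disjoint sets of `m` vertices are joined by an edge. -/
def Expanding (m : ℕ) (G : SimpleGraph V) : Prop :=
  ∀ A B : Finset V, A.card = m → B.card = m → Disjoint A B → ∃ a ∈ A, ∃ b ∈ B, G.Adj a b

theorem binomialRandom_not_expanding_le (p : unitInterval) (m : ℕ) :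
    (SimpleGraph.binomialRandom V p).real {G | ¬ Expanding m G} ≤
      (Fintype.card V : ℝ) ^ (2 * m) * (1 - p : ℝ) ^ (m * m) := by
  classical
  set μ := SimpleGraph.binomialRandom V p
  have hq0 : (0 : ℝ) ≤ 1 - p := by linarith [p.2.2]
  let P : Finset (Finset V) := Finset.univ.powersetCard m
  let I : Finset (Finset V × Finset V) := (P ×ˢ P).filter fun a => Disjoint a.1 a.2
  let F : Finset V × Finset V → Finset (Sym2 V) := fun a => (a.1 ×ˢ a.2).image fun z => s(z.1, z.2)
  have hsub : {G : SimpleGraph V | ¬ Expanding m G} ⊆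
      ⋃ a ∈ I, {G | ∀ e ∈ F a, e ∉ G.edgeSet} := by
    intro G hG
    simp only [Set.mem_ofPred_eq, Expanding] at hG
    push Not at hG
    obtain ⟨A, B, hA, hB, hAB, h⟩ := hG
    simp only [Set.mem_iUnion]
    refine ⟨(A, B), by simp [I, P, hA, hB, hAB], ?_⟩
    intro e he
    obtain ⟨⟨a, b⟩, hab, rfl⟩ := Finset.mem_image.1 he
    rw [Finset.mem_product] at hab
    simpa using h a hab.1 b hab.2
  have hterm : ∀ a ∈ I, μ.real {G | ∀ e ∈ F a, e ∉ G.edgeSet} = (1 - p : ℝ) ^ (m * m) := by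
    rintro ⟨A, B⟩ ha
    simp only [I, P, Finset.mem_filter, Finset.mem_product, Finset.mem_powersetCard] at ha
    obtain ⟨⟨⟨-, hA⟩, -, hB⟩, hAB⟩ := ha
    have hne : ∀ a ∈ A, ∀ b ∈ B, a ≠ b := fun a ha b hb h =>
      Finset.disjoint_left.1 hAB ha (h ▸ hb)
    rw [binomialRandom_absent]
    · congr 1
      rw [Finset.card_image_of_injOn, Finset.card_product, hA, hB]
      rintro ⟨a, b⟩ hab ⟨a', b'⟩ hab' h
      simp only [Finset.coe_product, Set.mem_prod, SetLike.mem_coe] at hab hab'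
      rcases Sym2.eq_iff.1 h with ⟨h1, h2⟩ | ⟨h1, h2⟩
      · exact Prod.ext h1 h2
      · exact absurd h1 (hne _ hab.1 _ hab'.2)
    · intro e he
      obtain ⟨⟨a, b⟩, hab, rfl⟩ := Finset.mem_image.1 he
      rw [Finset.mem_product] at hab
      rw [Sym2.mk_isDiag_iff]
      exact hne a hab.1 b hab.2
  have hI : I.card ≤ Fintype.card V ^ (2 * m) := by
    refine (Finset.card_filter_le _ _).trans ?_
    rw [Finset.card_product, Finset.card_powersetCard, Finset.card_univ, two_mul, pow_add]
    exact Nat.mul_le_mul (Nat.choose_le_pow _ _) (Nat.choose_le_pow _ _)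
  calc μ.real {G | ¬ Expanding m G} ≤ _ := measureReal_mono hsub (measure_ne_top _ _)
    _ ≤ _ := measureReal_biUnion_finset_le _ _
    _ = I.card * (1 - p : ℝ) ^ (m * m) := by
      rw [Finset.sum_congr rfl hterm, Finset.sum_const, nsmul_eq_mul]
    _ ≤ _ := by
      refine mul_le_mul_of_nonneg_right ?_ (pow_nonneg hq0 _)
      exact_mod_cast hI

/-- In an expanding graph, fewer than `2 m` vertices have no neighbour in a given colour class of
size at least `m`. Removing these vertices and the smaller colour classes `S i` leaves vertices
whose neighbourhood colour sets differ only in the colours of the classes `S i`. -/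
theorem exists_small_classes {G : SimpleGraph V} {m k : ℕ} (hG : Expanding m G) {c : V → Fin k}
    (hc : IsSetColouring G c) :
    ∃ (S : Fin k → Finset V) (X : Finset V), (Pairwise fun i j => Disjoint (S i) (S j)) ∧
      (∀ i, (S i).card ≤ m) ∧ X.card ≤ k * (3 * m) ∧ (∀ i, S i ⊆ X) ∧
      ∀ u ∉ X, ∀ v ∉ X, seen S G u = seen S G v → ¬ G.Adj u v := by
  classical
  let C : Fin k → Finset V := fun i => Finset.univ.filter fun v => c v = i
  let Q : Fin k → Finset V := fun i => Finset.univ.filter fun v => ∀ w ∈ C i, ¬ G.Adj v w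
  let S : Fin k → Finset V := fun i => if (C i).card < m then C i else ∅
  let B : Fin k → Finset V := fun i => if (C i).card < m then ∅ else Q i
  have hSC : ∀ i, S i ⊆ C i := by
    intro i
    simp only [S]
    split_ifs <;> simp
  have hScard : ∀ i, (S i).card ≤ m := by
    intro i
    simp only [S]
    split_ifs with h
    · exact h.le
    · simp
  have hBcard : ∀ i, (B i).card ≤ 2 * m := by
    intro i
    simp only [B]
    split_ifs with h
    · simp
    by_contra hlt
    obtain ⟨W, hWC, hW⟩ := Finset.exists_subset_card_eq (not_lt.1 h)
    have h1 : m ≤ (Q i \ W).card := by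
      have := Finset.le_card_sdiff W (Q i)
      omega
    obtain ⟨D, hDQ, hD⟩ := Finset.exists_subset_card_eq h1
    obtain ⟨w, hw, d, hd, hadj⟩ := hG W D hW hD
      (Finset.disjoint_left.2 fun z hz hz' => (Finset.mem_sdiff.1 (hDQ hz')).2 hz)
    have hdQ := (Finset.mem_sdiff.1 (hDQ hd)).1
    simp only [Q, Finset.mem_filter, Finset.mem_univ, true_and] at hdQ
    exact hdQ w (hWC hw) hadj.symm
  refine ⟨S, Finset.univ.biUnion fun i => S i ∪ B i, ?_, hScard, ?_, ?_, ?_⟩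
  · intro i j hij
    rw [Finset.disjoint_left]
    intro z hz hz'
    have h1 := hSC i hz
    have h2 := hSC j hz'
    simp only [C, Finset.mem_filter, Finset.mem_univ, true_and] at h1 h2
    exact hij (h1.symm.trans h2)
  · refine (Finset.card_biUnion_le_card_mul _ _ (3 * m) fun i _ => ?_).trans (by simp)
    refine (Finset.card_union_le _ _).trans ?_
    have := hScard i
    have := hBcard i
    omega
  · intro i z hz
    exact Finset.mem_biUnion.2 ⟨i, Finset.mem_univ i, Finset.mem_union_left _ hz⟩
  · intro u hu v hv huv hadj
    refine hc u v hadj ?_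
    have key : ∀ z, z ∉ (Finset.univ.biUnion fun i => S i ∪ B i) → ∀ i,
        i ∈ nbrColours G c z ↔ ((C i).card < m → i ∈ seen S G z) := by
      intro z hz i
      have hzB : z ∉ B i := fun h =>
        hz (Finset.mem_biUnion.2 ⟨i, Finset.mem_univ i, Finset.mem_union_right _ h⟩)
      have hmem : i ∈ nbrColours G c z ↔ ∃ w ∈ C i, G.Adj z w := by
        simp only [nbrColours, Set.mem_image, SimpleGraph.mem_neighborSet, C, Finset.mem_filter,
          Finset.mem_univ, true_and]
        exact ⟨fun ⟨w, h1, h2⟩ => ⟨w, h2, h1⟩, fun ⟨w, h1, h2⟩ => ⟨w, h2, h1⟩⟩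
      rw [hmem]
      by_cases h : (C i).card < m
      · simp only [h, seen, S, Finset.mem_filter, Finset.mem_univ, true_and, if_true, true_imp_iff]
      · simp only [h, false_imp_iff, iff_true]
        simp only [B, h, if_false, Q, Finset.mem_filter, Finset.mem_univ, true_and] at hzB
        push Not at hzB
        exact hzB
    ext i
    rw [key u hu, key v hv, huv]

/-- Every set of at most `j` vertices is the set of values of some `Fin j → Option V`. -/
theorem card_finset_card_le (j : ℕ) :
    (Finset.univ.filter fun A : Finset V => A.card ≤ j).card ≤ (Fintype.card V + 1) ^ j := by
  classical
  have : (Finset.univ.filter fun A : Finset V => A.card ≤ j) ⊆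
      (Finset.univ : Finset (Fin j → Option V)).image
        fun f => Finset.univ.filter fun a => ∃ t, f t = some a := by
    intro A hA
    rw [Finset.mem_filter] at hA
    refine Finset.mem_image.2 ⟨fun t => if h : t.1 < A.card then
      some (A.equivFin.symm ⟨t.1, h⟩ : V) else none, Finset.mem_univ _, ?_⟩
    ext a
    simp only [Finset.mem_filter, Finset.mem_univ, true_and]
    constructor
    · rintro ⟨t, ht⟩
      split_ifs at ht with h
      rw [← Option.some.inj ht]
      exact (A.equivFin.symm ⟨t.1, h⟩).2
    · intro ha
      have hlt := (A.equivFin ⟨a, ha⟩).2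
      refine ⟨⟨(A.equivFin ⟨a, ha⟩).1, hlt.trans_le hA.2⟩, ?_⟩
      simp [hlt]
  refine (Finset.card_le_card this).trans (Finset.card_image_le.trans ?_)
  simp

/-- Union bound over the small colour classes and the exceptional set of `exists_small_classes`. -/
theorem binomialRandom_isSetColouring_le (p : unitInterval) {k m N : ℕ} {D : ℝ}
    (hN : k * (3 * m) + 2 * N ≤ Fintype.card V)
    (hD : ∀ l : Fin k → ℕ,
      D ≤ N * collisionRate (subsetLaw fun i => (1 - p : ℝ) ^ l i) (p * N)) :
    (SimpleGraph.binomialRandom V p).real {G | ∃ c : V → Fin k, IsSetColouring G c} ≤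
      (Fintype.card V : ℝ) ^ (2 * m) * (1 - p : ℝ) ^ (m * m) +
        (Fintype.card V + 1 : ℝ) ^ (4 * (k * m)) * ((N + 1) * Real.exp (-(D / 4))) := by
  classical
  set μ := SimpleGraph.binomialRandom V p
  let I : Finset ((Fin k → Finset V) × Finset V) :=
    (Fintype.piFinset fun _ : Fin k => Finset.univ.filter fun A : Finset V => A.card ≤ m) ×ˢ
      (Finset.univ.filter fun A : Finset V => A.card ≤ k * (3 * m))
  let J := I.filter fun a => (Pairwise fun i j => Disjoint (a.1 i) (a.1 j)) ∧ ∀ i, a.1 i ⊆ a.2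
  let E : (Fin k → Finset V) × Finset V → Set (SimpleGraph V) := fun a =>
    {G | ∀ u ∉ a.2, ∀ v ∉ a.2, seen a.1 G u = seen a.1 G v → ¬ G.Adj u v}
  have hsub : {G : SimpleGraph V | ∃ c : V → Fin k, IsSetColouring G c} ⊆
      {G | ¬ Expanding m G} ∪ ⋃ a ∈ J, E a := by
    rintro G ⟨c, hc⟩
    by_cases hG : Expanding m G
    · right
      obtain ⟨S, X, h1, h2, h3, h4, h5⟩ := exists_small_classes hG hc
      simp only [Set.mem_iUnion]
      refine ⟨(S, X), ?_, h5⟩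
      simp only [J, I, Finset.mem_filter, Finset.mem_product, Fintype.mem_piFinset,
        Finset.mem_univ, true_and]
      exact ⟨⟨h2, h3⟩, h1, h4⟩
    · left
      exact hG
  have hJ : J.card ≤ (Fintype.card V + 1) ^ (4 * (k * m)) := by
    refine (Finset.card_filter_le _ _).trans ?_
    rw [Finset.card_product, Fintype.card_piFinset, Finset.prod_const, Finset.card_univ,
      Fintype.card_fin]
    refine (Nat.mul_le_mul (Nat.pow_le_pow_left (card_finset_card_le m) k)
      (card_finset_card_le _)).trans (le_of_eq ?_)
    rw [← pow_mul, ← pow_add]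
    congr 1
    ring
  have hterm : ∀ a ∈ J, μ.real (E a) ≤ (N + 1) * Real.exp (-(D / 4)) := by
    rintro ⟨S, X⟩ ha
    simp only [J, I, Finset.mem_filter, Finset.mem_product, Fintype.mem_piFinset,
        Finset.mem_univ, true_and] at ha
    obtain ⟨⟨-, hX⟩, hS, hSX⟩ := ha
    have h1 : N + N ≤ Xᶜ.card := by
      rw [Finset.card_compl]
      omega
    obtain ⟨U, hUX, hU⟩ := Finset.exists_subset_card_eq (le_of_add_le_left h1)
    have h2 : N ≤ (Xᶜ \ U).card := by
      rw [Finset.card_sdiff_of_subset hUX]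
      omega
    obtain ⟨W, hWX, hW⟩ := Finset.exists_subset_card_eq h2
    have hU' : ∀ u ∈ U, u ∉ X := fun u hu => Finset.mem_compl.1 (hUX hu)
    have hW' : ∀ u ∈ W, u ∉ X := fun u hu =>
      Finset.mem_compl.1 (Finset.mem_sdiff.1 (hWX hu)).1
    have hUW : Disjoint U W := Finset.disjoint_left.2 fun z hz hz' =>
      (Finset.mem_sdiff.1 (hWX hz')).2 hz
    refine (measureReal_mono (?_ : E (S, X) ⊆
      {G | ∀ u ∈ U, ∀ w ∈ W, seen S G u = seen S G w → ¬ G.Adj u w})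
      (measure_ne_top _ _)).trans ((binomialRandom_no_equal_seen_le p S hS hU hW hUW
        (fun i => Finset.disjoint_left.2 fun z hz hz' => hU' z hz' (hSX i hz))
        (fun i => Finset.disjoint_left.2 fun z hz hz' => hW' z hz' (hSX i hz))).trans ?_)
    · exact fun G hG u hu w hw => hG u (hU' u hu) w (hW' w hw)
    · refine mul_le_mul_of_nonneg_left (Real.exp_le_exp.2 ?_) (by positivity)
      have := hD fun i => (S i).card
      linarith
  calc μ.real {G : SimpleGraph V | ∃ c : V → Fin k, IsSetColouring G c}
      ≤ _ := measureReal_mono hsub (measure_ne_top _ _)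
    _ ≤ _ := measureReal_union_le _ _
    _ ≤ _ := by
      refine add_le_add (binomialRandom_not_expanding_le p m)
        ((measureReal_biUnion_finset_le _ _).trans ((Finset.sum_le_sum hterm).trans ?_))
      rw [Finset.sum_const, nsmul_eq_mul]
      refine mul_le_mul_of_nonneg_right ?_ (by positivity)
      exact_mod_cast hJ

end RandomGraph

/-! ### Asymptotics -/

section Asymptotics

open MeasureTheory

theorem IsSetColouring.comp_injective {V α β : Type*} {G : SimpleGraph V} {c : V → α}
    (hc : IsSetColouring G c) {f : α → β} (hf : Function.Injective f) :
    IsSetColouring G (f ∘ c) := by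
  intro u v huv h
  refine hc u v huv (hf.image_injective ?_)
  simpa only [nbrColours, Set.image_comp] using h

/-- The number of colours is the largest integer below `R`. -/
theorem exists_isSetColouring_of_lt {n : ℕ} {G : SimpleGraph (Fin n)} {R : ℝ}
    (h : (setChromaticNumber G : ℝ) < R) :
    ∃ c : Fin n → Fin (⌈R⌉₊ - 1), IsSetColouring G c := by
  obtain ⟨c, hc⟩ := exists_isSetColouring_setChromaticNumber G
  have := Nat.lt_ceil.2 h
  exact ⟨_, hc.comp_injective (Fin.castLE_injective (by omega : _ ≤ ⌈R⌉₊ - 1))⟩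

theorem natCast_ceil_sub_one_le {R : ℝ} (hR : 0 ≤ R) : ((⌈R⌉₊ - 1 : ℕ) : ℝ) ≤ R := by
  rcases Nat.eq_zero_or_pos ⌈R⌉₊ with h | h
  · simpa [h] using hR
  · rw [Nat.cast_sub h]
    have := Nat.ceil_lt_add_one hR
    push_cast
    linarith

theorem aas_of_tendsto {p : ℕ → unitInterval} {R : ℕ → ℝ}
    (h : Tendsto (fun n : ℕ => (SimpleGraph.binomialRandom (Fin n) (p n)).real
      {G | ∃ c : Fin n → Fin (⌈R n⌉₊ - 1), IsSetColouring G c}) atTop (𝓝 0)) :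
    AAS p fun n G => R n ≤ (setChromaticNumber G : ℝ) := by
  have h1 : Tendsto (fun n : ℕ => (SimpleGraph.binomialRandom (Fin n) (p n)).real
      {G | R n ≤ (setChromaticNumber G : ℝ)}ᶜ) atTop (𝓝 0) := by
    refine squeeze_zero (fun _ => measureReal_nonneg) (fun n => ?_) h
    refine measureReal_mono (fun G hG => ?_) (measure_ne_top _ _)
    exact exists_isSetColouring_of_lt (not_le.1 hG)
  have h2 := ENNReal.tendsto_ofReal (h1.const_sub 1)
  rw [sub_zero, ENNReal.ofReal_one] at h2
  refine h2.congr fun n => ?_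
  rw [← probReal_compl_eq_one_sub (measurableSet_simpleGraph _), compl_compl, ofReal_measureReal]

/-- The two error terms of `binomialRandom_isSetColouring_le` with `m = ⌈3 log n / p⌉` and
`N = ⌊n / 4⌋`. -/
theorem tendsto_binomialRandom_isSetColouring {p : ℕ → unitInterval} {k : ℕ → ℕ} {D : ℕ → ℝ}
    (hp : ∀ᶠ n in atTop, 0 < (p n : ℝ))
    (hk : ∀ᶠ n : ℕ in atTop, 24 * (k n * (Real.log n / p n)) ≤ n)
    (hD : ∀ᶠ n : ℕ in atTop, 400 * (k n * Real.log n ^ 2 / p n) + 100 * Real.log n ≤ D n)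
    (hrate : ∀ᶠ n : ℕ in atTop, ∀ l : Fin (k n) → ℕ, D n ≤ (n / 4 : ℕ) *
      collisionRate (subsetLaw fun i => (1 - p n : ℝ) ^ l i) (p n * (n / 4 : ℕ))) :
    Tendsto (fun n : ℕ => (SimpleGraph.binomialRandom (Fin n) (p n)).real
      {G | ∃ c : Fin n → Fin (k n), IsSetColouring G c}) atTop (𝓝 0) := by
  have hlim : Tendsto (fun n : ℕ => 2 / (n : ℝ)) atTop (𝓝 0) :=
    tendsto_const_div_atTop_nhds_zero_nat 2
  have hlog : ∀ᶠ n : ℕ in atTop, 1 ≤ Real.log n :=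
    (Real.tendsto_log_atTop.comp tendsto_natCast_atTop_atTop).eventually_ge_atTop 1
  refine squeeze_zero' (Eventually.of_forall fun _ => measureReal_nonneg) ?_ hlim
  filter_upwards [hp, hk, hD, hrate, hlog, eventually_ge_atTop 2] with n hp hk hD hrate hlog hn
  have hn' : (2 : ℝ) ≤ n := by exact_mod_cast hn
  have hn0 : (0 : ℝ) < n := by linarith
  have hp1 : (p n : ℝ) ≤ 1 := (p n).2.2
  set a : ℝ := Real.log n with ha
  set P : ℝ := (p n : ℝ) with hP
  set m : ℕ := ⌈3 * a / P⌉₊ with hm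
  have hm3 : 3 * a / P ≤ m := Nat.le_ceil _
  have haP : 1 ≤ a / P := by
    rw [le_div_iff₀ hp]
    linarith
  have hm4 : (m : ℝ) ≤ 4 * (a / P) := by
    have := (Nat.ceil_lt_add_one (by positivity : 0 ≤ 3 * a / P)).le
    rw [← hm, mul_div_assoc] at this
    linarith
  have hPm : 3 * a ≤ P * m := by
    rw [div_le_iff₀ hp] at hm3
    linarith
  have hm1 : (1 : ℝ) ≤ m := by
    rw [mul_div_assoc] at hm3
    linarith
  have hexpa : Real.exp (-a) = 1 / n := by
    rw [ha, Real.exp_neg, Real.exp_log hn0, one_div]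
  have hkm : (k n : ℝ) * m ≤ 4 * (k n * (a / P)) := by
    have := mul_le_mul_of_nonneg_left hm4 (Nat.cast_nonneg (α := ℝ) (k n))
    linarith
  have hN : k n * (3 * m) + 2 * (n / 4) ≤ Fintype.card (Fin n) := by
    rw [Fintype.card_fin]
    have h1 : (6 * (k n * m) : ℝ) ≤ n := by linarith
    have h2 : 6 * (k n * m) ≤ n := by exact_mod_cast h1
    have h3 : k n * (3 * m) = 3 * (k n * m) := by ring
    omega
  refine (binomialRandom_isSetColouring_le (p n) hN hrate).trans ?_
  rw [Fintype.card_fin]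
  have hA : (n : ℝ) ^ (2 * m) * (1 - P) ^ (m * m) ≤ 1 / n := by
    have h1 : (n : ℝ) ^ (2 * m) = Real.exp ((2 * m : ℕ) * a) := by
      rw [Real.exp_nat_mul, ha, Real.exp_log hn0]
    have h2 : (1 - P) ^ (m * m) ≤ Real.exp ((m * m : ℕ) * (-P)) := by
      rw [Real.exp_nat_mul]
      exact pow_le_pow_left₀ (by linarith) (by linarith [Real.add_one_le_exp (-P)]) _
    rw [h1, ← hexpa]
    refine (mul_le_mul_of_nonneg_left h2 (Real.exp_pos _).le).trans ?_
    rw [← Real.exp_add, Real.exp_le_exp]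
    push_cast
    nlinarith
  have hB : (n + 1 : ℝ) ^ (4 * (k n * m)) * (((n / 4 : ℕ) + 1) * Real.exp (-(D n / 4))) ≤
      1 / n := by
    have h0 : (n : ℝ) + 1 ≤ Real.exp (2 * a) := by
      have : Real.exp (2 * a) = (n : ℝ) ^ 2 := by
        rw [ha, mul_comm, Real.exp_mul, Real.exp_log hn0]
        norm_num
      rw [this]
      nlinarith
    have h1 : (n + 1 : ℝ) ^ (4 * (k n * m)) ≤ Real.exp ((4 * (k n * m) : ℕ) * (2 * a)) := by
      rw [Real.exp_nat_mul]
      exact pow_le_pow_left₀ (by linarith) h0 _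
    have h2 : ((n / 4 : ℕ) + 1 : ℝ) ≤ Real.exp (2 * a) := by
      refine le_trans ?_ h0
      have : n / 4 ≤ n := Nat.div_le_self _ _
      have : ((n / 4 : ℕ) : ℝ) ≤ n := by exact_mod_cast this
      linarith
    rw [← hexpa]
    refine (mul_le_mul h1 (mul_le_mul_of_nonneg_right h2 (Real.exp_pos _).le)
      (by positivity) (Real.exp_pos _).le).trans ?_
    rw [← Real.exp_add, ← Real.exp_add, Real.exp_le_exp]
    push_cast
    have h3 : (k n : ℝ) * m * a ≤ 4 * (k n * a ^ 2 / P) := by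
      have := mul_le_mul_of_nonneg_right hkm (by linarith : 0 ≤ a)
      refine this.trans (le_of_eq ?_)
      ring
    have h4 : 0 ≤ k n * a ^ 2 / P := by positivity
    linarith
  have : (2 : ℝ) / n = 1 / n + 1 / n := by ring
  rw [this]
  exact add_le_add hA hB

/-- The collision rate for `x = n p`, where `L = log n · log (n p)` and `s ^ k ≥ (L / x)²`. For
`p ≤ n ^ (-1/2)` the bound comes from the number `2 ^ k` of types. For larger `p`, either the
collision probability is so large that the general bound `min (b q) (√q)` suffices, or it is so
close to its minimum that the types are nearly equidistributed. -/
theorem le_collisionRate_of_sparse {n k : ℕ} {p L x b : ℝ} (hp0 : 0 < p) (hp : p ^ 2 ≤ 1 / 128)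
    (hx : x = n * p) (hn : 32 * Real.log n ≤ n) (hn1 : 1 ≤ Real.log n)
    (hnlog : Real.log n ^ 48 ≤ n) (hL : 3 ≤ L) (hLn : L ≤ Real.log n ^ 2) (hLx : L ^ 2 ≤ x)
    (hk : (k : ℝ) ≤ 8 * Real.log n) (hs : L ^ 2 / x ^ 2 ≤ s p ^ k)
    (hb1 : x / 5 ≤ b) (hb2 : b ≤ x / 4) (l : Fin k → ℕ) :
    L ^ 2 / (60 * x) ≤ collisionRate (subsetLaw fun i => (1 - p) ^ l i) b := by
  have hx0 : 0 < x := lt_of_lt_of_le (by positivity) hLx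
  have hb0 : 0 < b := by linarith
  have hn0 : (0 : ℝ) < n := by linarith
  have hphalf : p ≤ 1 / 2 := by nlinarith
  have hy0 : ∀ i, 0 ≤ (1 - p) ^ l i := fun i => pow_nonneg (by linarith) _
  have hy1 : ∀ i, (1 - p) ^ l i ≤ 1 := fun i => pow_le_one₀ (by linarith) (by linarith)
  have hπ := subsetLaw_nonneg hy0 hy1
  have hπ1 := sum_subsetLaw fun i => (1 - p) ^ l i
  have hq := s_pow_le_sum_subsetLaw_sq p l
  have hπ3 := sum_subsetLaw_cube_le hy0 hy1
  set π := subsetLaw fun i => (1 - p) ^ l i with hπdef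
  set q := ∑ T, π T ^ 2 with hqdef
  have hr0 : 0 < L ^ 2 / x ^ 2 := by positivity
  have hq0 : 0 < q := hr0.trans_le (hs.trans hq)
  -- `2 ^ k` exceeds `s ^ (-k)` by a factor of at most `(1 + 4 p ^ 2) ^ k`.
  have htwo : 2 ^ k * (L ^ 2 / x ^ 2) ≤ Real.exp (4 * p ^ 2 * k) := by
    have h1 : 2 ^ k * s p ^ k ≤ Real.exp (4 * p ^ 2) ^ k := by
      rw [← mul_pow]
      refine pow_le_pow_left₀ (by linarith [half_le_s p]) ?_ k
      linarith [s_le_half_add hp0 hphalf, Real.add_one_le_exp (4 * p ^ 2)]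
    rw [mul_comm _ (k : ℝ), Real.exp_nat_mul]
    exact (mul_le_mul_of_nonneg_left hs (by positivity)).trans h1
  have hLx2 : L ^ 2 / x ≤ 1 := (div_le_one hx0).2 hLx
  have hgoal : L ^ 2 / (60 * x) = L ^ 2 / x / 60 := by
    field_simp
  rcases le_total (p ^ 2 * n) 1 with hcase | hcase
  · have h1 : 4 * p ^ 2 * k ≤ 1 := by
      have : p ^ 2 * k ≤ p ^ 2 * (n / 4) :=
        mul_le_mul_of_nonneg_left (by linarith) (by positivity)
      nlinarith
    have h2 : 2 ^ k * (L ^ 2 / x ^ 2) ≤ 3 :=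
      htwo.trans ((Real.exp_le_exp.2 h1).trans (by linarith [Real.exp_one_lt_d9]))
    have h3 : L ^ 2 / x / 30 ≤ b / (2 * Fintype.card (Finset (Fin k))) := by
      rw [Fintype.card_finset, Fintype.card_fin]
      push_cast
      rw [le_div_iff₀ (by positivity)]
      have : L ^ 2 / x / 30 * (2 * 2 ^ k) = x / 15 * (2 ^ k * (L ^ 2 / x ^ 2)) := by
        field_simp
        norm_num
      rw [this]
      nlinarith
    have h4 := half_min_le_collisionRate hπ hπ1 hb0.le
    have h5 : L ^ 2 / x / 30 ≤ min 1 (b / (2 * Fintype.card (Finset (Fin k)))) :=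
      le_min (by linarith) h3
    rw [hgoal]
    linarith
  · rcases le_total (L ^ 2 / x) √q with hq1 | hq1
    · refine le_trans (le_min ?_ ?_) (min_mul_sqrt_le_collisionRate hπ hπ1 hb0.le)
      · have h1 : (L ^ 2 / x) ^ 2 ≤ q := (Real.le_sqrt (by positivity) hq0.le).1 hq1
        have h2 : b * (L ^ 2 / x) ^ 2 ≤ b * q := mul_le_mul_of_nonneg_left h1 hb0.le
        refine le_trans ?_ h2
        have h3 : x / 5 * (L ^ 2 / x) ^ 2 ≤ b * (L ^ 2 / x) ^ 2 :=
          mul_le_mul_of_nonneg_right hb1 (by positivity)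
        refine le_trans ?_ h3
        have h4 : x / 5 * (L ^ 2 / x) ^ 2 = L ^ 2 / x * (L ^ 2 / 5) := by
          field_simp
        rw [h4, hgoal]
        have h5 : (0 : ℝ) < L ^ 2 / x := by positivity
        have h6 : (1 : ℝ) / 60 ≤ L ^ 2 / 5 := by nlinarith
        linarith [mul_le_mul_of_nonneg_left h6 h5.le]
      · refine le_trans ?_ hq1
        rw [hgoal]
        have : (0 : ℝ) < L ^ 2 / x := by positivity
        linarith
    · have h1 : q ≤ (L ^ 2 / x) ^ 2 := (Real.sqrt_le_iff.1 hq1).2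
      -- All of `L ^ 6`, `(2 s) ^ k` and `x` are compared with `w = n ^ (1 / 4)`.
      set w := Real.exp (Real.log n / 4) with hw
      have hw0 : 0 < w := Real.exp_pos _
      have hw4 : w ^ 4 = n := by
        rw [hw, ← Real.exp_nat_mul]
        push_cast
        rw [mul_div_cancel₀ _ (by norm_num), Real.exp_log hn0]
      have hwL : L ^ 6 ≤ w := by
        have h2 : L ^ 6 ≤ (Real.log n ^ 2) ^ 6 := pow_le_pow_left₀ (by linarith) hLn 6
        refine h2.trans (le_of_pow_le_pow_left₀ (n := 4) (by norm_num) hw0.le ?_)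
        rw [hw4, ← pow_mul, ← pow_mul]
        exact hnlog
      have hwk : Real.exp (4 * p ^ 2 * k) ≤ w := by
        rw [hw, Real.exp_le_exp]
        have : p ^ 2 * k ≤ 1 / 128 * (8 * Real.log n) :=
          mul_le_mul hp hk (by positivity) (by norm_num)
        linarith
      have hwx : w ^ 2 ≤ x := by
        refine le_of_pow_le_pow_left₀ (n := 2) (by norm_num) hx0.le ?_
        rw [← pow_mul, hw4, hx]
        nlinarith
      have hq2 : b * (2 ^ k * q ^ 2) ≤ 2 := by
        have h2 : q ^ 2 ≤ ((L ^ 2 / x) ^ 2) ^ 2 := pow_le_pow_left₀ hq0.le h1 2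
        have h3 : b * (2 ^ k * q ^ 2) ≤ x * (2 ^ k * ((L ^ 2 / x) ^ 2) ^ 2) :=
          mul_le_mul (by linarith) (mul_le_mul_of_nonneg_left h2 (by positivity))
            (by positivity) hx0.le
        refine h3.trans ?_
        have h4 : x * (2 ^ k * ((L ^ 2 / x) ^ 2) ^ 2) =
            (2 ^ k * (L ^ 2 / x ^ 2)) * L ^ 6 / x := by
          field_simp
        rw [h4, div_le_iff₀ hx0]
        have h5 : 2 ^ k * (L ^ 2 / x ^ 2) * L ^ 6 ≤ w * w :=
          mul_le_mul (htwo.trans hwk) hwL (by positivity) hw0.le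
        rw [← pow_two] at h5
        linarith
      have h2 : b ^ 2 * ∑ T, π T ^ 3 ≤ 2 * (b * q) := by
        have h3 : b ^ 2 * ∑ T, π T ^ 3 ≤ b ^ 2 * (2 ^ k * q ^ 3) :=
          mul_le_mul_of_nonneg_left hπ3 (by positivity)
        have h4 : b ^ 2 * (2 ^ k * q ^ 3) = b * (2 ^ k * q ^ 2) * (b * q) := by ring
        have h5 : b * (2 ^ k * q ^ 2) * (b * q) ≤ 2 * (b * q) :=
          mul_le_mul_of_nonneg_right hq2 (by positivity)
        linarith
      refine le_trans ?_ (half_mul_le_collisionRate hπ h2)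
      have h3 : x / 5 * (L ^ 2 / x ^ 2) ≤ b * q :=
        mul_le_mul hb1 (hs.trans hq) hr0.le hb0.le
      have h4 : x / 5 * (L ^ 2 / x ^ 2) = L ^ 2 / x / 5 := by field_simp
      have : (0 : ℝ) < L ^ 2 / x := by positivity
      rw [hgoal]
      linarith

theorem natCast_div_four_ge {n : ℕ} (hn : 20 ≤ n) : (n : ℝ) / 5 ≤ (n / 4 : ℕ) := by
  have h : n ≤ 5 * (n / 4) := by omega
  have : (n : ℝ) ≤ 5 * (n / 4 : ℕ) := by exact_mod_cast h
  linarith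

theorem natCast_div_four_le (n : ℕ) : ((n / 4 : ℕ) : ℝ) ≤ n / 4 := by
  have h : 4 * (n / 4) ≤ n := by omega
  have : (4 * (n / 4 : ℕ) : ℝ) ≤ n := by exact_mod_cast h
  linarith

theorem aas_sparse {p : ℕ → unitInterval}
    (hnp : Tendsto (fun n : ℕ => (n : ℝ) * (p n : ℝ)) atTop atTop)
    (hlow : (fun n : ℕ => Real.log n ^ 2 * Real.log ((n : ℝ) * (p n : ℝ)) ^ 2 / (n : ℝ))
      =o[atTop] (fun n : ℕ => (p n : ℝ)))
    (hp : Tendsto (fun n : ℕ => (p n : ℝ)) atTop (𝓝 0)) :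
    AAS p fun n G => rSparse n (p n) * Real.logb 2 n ≤ (setChromaticNumber G : ℝ) := by
  have hlogn : Tendsto (fun n : ℕ => Real.log n) atTop atTop :=
    Real.tendsto_log_atTop.comp tendsto_natCast_atTop_atTop
  have hlogx := Real.tendsto_log_atTop.comp hnp
  have hp2 : ∀ᶠ n in atTop, (p n : ℝ) < 1 / 16 := hp.eventually (gt_mem_nhds (by norm_num))
  have hlog48 : ∀ᶠ n : ℕ in atTop, Real.log n ^ 48 ≤ n := by
    have := (Real.isLittleO_pow_log_id_atTop (n := 48)).bound one_pos
    filter_upwards [tendsto_natCast_atTop_atTop.eventually this, hlogn.eventually_ge_atTop 0]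
      with n h1 h2
    simpa [abs_of_nonneg h2] using h1
  -- The bound `L² ≤ n p` is where `p ≫ L² / n` enters.
  have hev : ∀ᶠ n : ℕ in atTop, 20 ≤ n ∧ 0 < (p n : ℝ) ∧ (p n : ℝ) < 1 / 16 ∧
      32 * Real.log n ≤ n ∧ Real.log n ^ 48 ≤ n ∧ 1000000 ≤ Real.log (n * p n) ∧
      Real.log (n * p n) ≤ Real.log n ∧
      (Real.log n * Real.log (n * p n)) ^ 2 ≤ n * p n := by
    have hid := Real.isLittleO_log_id_atTop.bound (by norm_num : (0 : ℝ) < 1 / 32)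
    filter_upwards [eventually_ge_atTop 20, hp2, tendsto_natCast_atTop_atTop.eventually hid, hlog48,
      hlogx.eventually_ge_atTop 1000000, hlow.bound one_pos, hnp.eventually_gt_atTop 0,
      hlogn.eventually_ge_atTop 0] with n h1 h2 h3 h4 h5 h6 h7 h8
    have hn0 : (0 : ℝ) < n := by
      have : 0 < n := by omega
      exact_mod_cast this
    have hp0 : 0 < (p n : ℝ) := pos_of_mul_pos_right h7 hn0.le
    refine ⟨h1, hp0, h2, ?_, h4, h5, ?_, ?_⟩
    · simp only [Real.norm_eq_abs, id, abs_of_nonneg h8, abs_of_pos hn0] at h3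
      linarith
    · exact Real.log_le_log h7 (mul_le_of_le_one_right hn0.le (p n).2.2)
    · rw [Real.norm_of_nonneg (by positivity), one_mul, Real.norm_of_nonneg hp0.le,
        div_le_iff₀ hn0] at h6
      rw [mul_pow]
      linarith
  -- `s ^ (r lg n) = L² / (n p)²`, and hence `0 ≤ r lg n ≤ 8 log (n p)`.
  have hR : ∀ᶠ n : ℕ in atTop, 0 ≤ rSparse n (p n) * Real.logb 2 n ∧
      rSparse n (p n) * Real.logb 2 n ≤ 8 * Real.log (n * p n) ∧
      s (p n) ^ (rSparse n (p n) * Real.logb 2 n) =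
        (Real.log n * Real.log (n * p n)) ^ 2 / (n * p n) ^ 2 := by
    filter_upwards [hev] with n ⟨h1, h2, h3, h4, h5, h6, h7, h8⟩
    have hn0 : (0 : ℝ) < n := by
      have : 0 < n := by omega
      exact_mod_cast this
    have hx0 : 0 < (n : ℝ) * p n := by positivity
    have hs0 : 0 < s (p n) := by linarith [half_le_s (p n)]
    have hs34 : s (p n) ≤ 3 / 4 := by
      have := s_le_half_add h2 (by linarith)
      nlinarith
    have hL1 : 1 ≤ Real.log n * Real.log (n * p n) := by nlinarith
    have hx1 : 1 < (n : ℝ) * p n := by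
      by_contra hlt
      have := Real.log_nonpos hx0.le (not_lt.1 hlt)
      linarith
    have hspec := (rSparse_spec (by omega : 2 ≤ n) hx1 hs0 (by linarith) _).2 rfl
    have heq : s (p n) ^ (rSparse n (p n) * Real.logb 2 n) =
        (Real.log n * Real.log (n * p n)) ^ 2 / (n * p n) ^ 2 := by
      rw [eq_div_iff (pow_ne_zero 2 hx0.ne'), mul_pow (Real.log n), ← hspec]
      ring
    have hlog := congrArg Real.log heq
    rw [Real.log_rpow hs0, Real.log_div (by positivity) (by positivity), Real.log_pow,
      Real.log_pow] at hlog
    have hls : Real.log (s (p n)) ≤ -(1 / 4) := by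
      linarith [Real.log_le_sub_one_of_pos hs0]
    have hLx : Real.log (Real.log n * Real.log (n * p n)) ≤ Real.log (n * p n) :=
      Real.log_le_log (by linarith) (by nlinarith)
    have hL0 : 0 ≤ Real.log (Real.log n * Real.log (n * p n)) := Real.log_nonneg hL1
    push_cast at hlog
    have hR0 : 0 ≤ rSparse n (p n) * Real.logb 2 n := by
      by_contra hneg
      nlinarith
    refine ⟨hR0, ?_, heq⟩
    nlinarith
  have hk : ∀ᶠ n : ℕ in atTop,
      ((⌈rSparse n (p n) * Real.logb 2 n⌉₊ - 1 : ℕ) : ℝ) ≤ 8 * Real.log (n * p n) := by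
    filter_upwards [hR] with n h
    exact (natCast_ceil_sub_one_le h.1).trans h.2.1
  refine aas_of_tendsto (tendsto_binomialRandom_isSetColouring
    (D := fun n => (Real.log n * Real.log (n * p n)) ^ 2 / (300 * p n)) ?_ ?_ ?_ ?_)
  · exact hev.mono fun n h => h.2.1
  · filter_upwards [hev, hk] with n ⟨h1, h2, h3, h4, h5, h6, h7, h8⟩ hk
    set a := Real.log n
    set g := Real.log (n * p n)
    rw [mul_div_assoc', mul_div_assoc', div_le_iff₀ h2]
    refine le_trans ?_ h8
    have : ((⌈rSparse n (p n) * Real.logb 2 n⌉₊ - 1 : ℕ) : ℝ) * a ≤ 8 * g * a :=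
      mul_le_mul_of_nonneg_right hk (by linarith)
    have hag : 1000000 ≤ a * g := by nlinarith
    nlinarith
  · filter_upwards [hev, hk] with n ⟨h1, h2, h3, h4, h5, h6, h7, h8⟩ hk
    set a := Real.log n
    set g := Real.log (n * p n)
    have h9 : ((⌈rSparse n (p n) * Real.logb 2 n⌉₊ - 1 : ℕ) : ℝ) * a ^ 2 / p n ≤
        8 * g * a ^ 2 / p n := by gcongr
    have h10 : a ≤ g * a ^ 2 / p n := by
      rw [le_div_iff₀ h2]
      nlinarith [mul_pos (by linarith : 0 < a) (by linarith : 0 < g)]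
    have h11 : (a * g) ^ 2 / (300 * p n) = g / 300 * (g * a ^ 2 / p n) := by
      field_simp
    have h12 : 8 * g * a ^ 2 / p n = 8 * (g * a ^ 2 / p n) := by ring
    rw [h11]
    nlinarith
  · filter_upwards [hev, hk, hR] with n ⟨h1, h2, h3, h4, h5, h6, h7, h8⟩ hk ⟨hR0, _, hsR⟩ l
    have hn0 : (0 : ℝ) < n := by
      have : 0 < n := by omega
      exact_mod_cast this
    have hs0 : 0 < s (p n) := by linarith [half_le_s (p n)]
    have hs1 : s (p n) ≤ 1 := by
      have := s_le_half_add h2 (by linarith)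
      nlinarith
    have hN5 := natCast_div_four_ge h1
    have hN4 := natCast_div_four_le n
    have hb1 : (n * p n : ℝ) / 5 ≤ p n * (n / 4 : ℕ) := by nlinarith
    have hb2 : (p n : ℝ) * (n / 4 : ℕ) ≤ (n * p n : ℝ) / 4 := by nlinarith
    have hrate := le_collisionRate_of_sparse (L := Real.log n * Real.log (n * p n)) h2
      (by nlinarith) rfl h4 (by linarith) h5 (by nlinarith) (by nlinarith) h8 (by linarith)
      (by
        rw [← hsR, ← Real.rpow_natCast]
        exact Real.rpow_le_rpow_of_exponent_ge hs0 hs1 (natCast_ceil_sub_one_le hR0))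
      hb1 hb2 l
    refine le_trans (le_of_eq ?_) (mul_le_mul hN5 hrate (by positivity) (Nat.cast_nonneg _))
    field_simp
    ring

theorem s_lt_one {p : ℝ} (h0 : 0 < p) (h1 : p < 1) : s p < 1 := by
  refine (s_le_sVal p 1).trans_lt ?_
  unfold sVal
  nlinarith

/-- The error `η n = -6 log log n / log n` gives `s ^ k ≥ (log n) ^ 12 / n ^ 2`. -/
theorem aas_const {c : unitInterval} (hc0 : 0 < (c : ℝ)) (hc1 : (c : ℝ) < 1) :
    ∃ η : ℕ → ℝ, Tendsto η atTop (𝓝 0) ∧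
      AAS (fun _ => c) fun n G =>
        (1 + η n) * rConst c * Real.logb 2 n ≤ (setChromaticNumber G : ℝ) := by
  have hlogn : Tendsto (fun n : ℕ => Real.log n) atTop atTop :=
    Real.tendsto_log_atTop.comp tendsto_natCast_atTop_atTop
  have hs0 : 0 < s c := by linarith [half_le_s c]
  have hs1 := s_lt_one hc0 hc1
  have hls : Real.log (s c) < 0 := Real.log_neg hs0 hs1
  have h2 : 0 < Real.log 2 := Real.log_pos (by norm_num)
  set η : ℕ → ℝ := fun n => -6 * (Real.log (Real.log n) / Real.log n) with hη
  have hηlim : Tendsto η atTop (𝓝 0) := by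
    have := (Real.isLittleO_log_id_atTop.tendsto_div_nhds_zero.comp hlogn).const_mul (-6)
    simpa [hη] using this
  refine ⟨η, hηlim, ?_⟩
  -- `(1 + η) r lg n = K (log n - 6 log log n)` for a constant `K`.
  set K : ℝ := 2 / -Real.log (s c) with hK
  have hK0 : 0 < K := div_pos two_pos (by linarith)
  have hRK : ∀ n : ℕ, 0 < Real.log n → (1 + η n) * rConst c * Real.logb 2 n =
      K * (Real.log n - 6 * Real.log (Real.log n)) := by
    intro n hn
    have hls' : Real.log (s c) ≠ 0 := hls.ne
    simp only [hη, rConst, hK, Real.logb, one_div, Real.log_inv]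
    field_simp
    ring
  have hev : ∀ᶠ n : ℕ in atTop, 20 ≤ n ∧ 1 ≤ Real.log n ∧
      0 ≤ Real.log n - 6 * Real.log (Real.log n) ∧ 24 * (K * Real.log n ^ 2 / c) ≤ n ∧
      5 / (c : ℝ) ≤ Real.log n ∧ 5 * (400 * K / c + 100) ≤ Real.log n := by
    have hid := (Real.isLittleO_log_id_atTop.comp_tendsto hlogn).bound
      (by norm_num : (0 : ℝ) < 1 / 6)
    have hsq := (Real.isLittleO_pow_log_id_atTop (n := 2)).bound
      (by positivity : 0 < (c : ℝ) / (24 * K))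
    filter_upwards [eventually_ge_atTop 20, hlogn.eventually_ge_atTop 1, hid,
      tendsto_natCast_atTop_atTop.eventually hsq, hlogn.eventually_ge_atTop _,
      hlogn.eventually_ge_atTop _] with n h1 h3 h4 h5 h6 h7
    refine ⟨h1, h3, ?_, ?_, h6, h7⟩
    · simp only [Function.comp_apply, Real.norm_eq_abs, id] at h4
      rw [abs_of_nonneg (Real.log_nonneg h3), abs_of_nonneg (by linarith : 0 ≤ Real.log n)] at h4
      linarith
    · rw [Real.norm_of_nonneg (by positivity), id, Real.norm_of_nonneg (by positivity),
        div_mul_eq_mul_div, le_div_iff₀ (by positivity)] at h5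
      rw [mul_div_assoc', div_le_iff₀ hc0]
      linarith
  have hk : ∀ᶠ n : ℕ in atTop,
      ((⌈(1 + η n) * rConst c * Real.logb 2 n⌉₊ - 1 : ℕ) : ℝ) ≤ K * Real.log n := by
    filter_upwards [hev] with n ⟨h1, h3, h4, _⟩
    rw [hRK n (by linarith)]
    refine (natCast_ceil_sub_one_le (mul_nonneg hK0.le h4)).trans ?_
    exact mul_le_mul_of_nonneg_left (by linarith [Real.log_nonneg h3]) hK0.le
  refine aas_of_tendsto (tendsto_binomialRandom_isSetColouring
    (D := fun n => Real.log n ^ 6 / 5) ?_ ?_ ?_ ?_)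
  · exact Eventually.of_forall fun _ => hc0
  · filter_upwards [hev, hk] with n ⟨h1, h3, h4, h5, h6, h7⟩ hk
    refine le_trans ?_ h5
    have h8 := mul_le_mul_of_nonneg_right hk (by positivity : 0 ≤ Real.log n / c)
    have h9 : K * Real.log n * (Real.log n / c) = K * Real.log n ^ 2 / c := by ring
    linarith
  · filter_upwards [hev, hk] with n ⟨h1, h3, h4, h5, h6, h7⟩ hk
    set a := Real.log n
    have h8 : ((⌈(1 + η n) * rConst c * Real.logb 2 n⌉₊ - 1 : ℕ) : ℝ) * a ^ 2 / c ≤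
        K * a * a ^ 2 / c := by gcongr
    have h9 : K * a * a ^ 2 / c = K / c * a ^ 3 := by ring
    have h10 : a ≤ a ^ 3 := le_self_pow₀ h3 (by norm_num)
    have h11 : a * a ^ 3 ≤ a ^ 6 := by
      rw [← pow_succ']
      exact pow_le_pow_right₀ h3 (by norm_num)
    have h12 : 5 * (400 * K / c + 100) * a ^ 3 ≤ a * a ^ 3 :=
      mul_le_mul_of_nonneg_right h7 (by positivity)
    have h13 : 400 * K / (c : ℝ) = 400 * (K / c) := by ring
    rw [h13] at h12
    linarith
  · filter_upwards [hev] with n ⟨h1, h3, h4, h5, h6, h7⟩ l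
    have hn0 : (0 : ℝ) < n := by
      have : 0 < n := by omega
      exact_mod_cast this
    set a := Real.log n with ha
    have hN5 := natCast_div_four_ge h1
    have hy0 : ∀ i, 0 ≤ (1 - c : ℝ) ^ l i := fun i => pow_nonneg (by linarith) _
    have hy1 : ∀ i, (1 - c : ℝ) ^ l i ≤ 1 := fun i => pow_le_one₀ (by linarith) (by linarith)
    have hsk : (a ^ 6 / n) ^ 2 ≤ s c ^ (⌈(1 + η n) * rConst c * Real.logb 2 n⌉₊ - 1) := by
      have h8 : (a ^ 6 / n) ^ 2 = s c ^ (K * (a - 6 * Real.log a)) := by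
        rw [← Real.exp_log (by positivity : 0 < (a ^ 6 / n) ^ 2), Real.rpow_def_of_pos hs0,
          Real.log_pow, Real.log_div (by positivity) hn0.ne', Real.log_pow, ← ha, hK]
        congr 1
        have : Real.log (s c) ≠ 0 := hls.ne
        field_simp
        push_cast
        ring
      rw [h8, hRK n (by linarith), ← Real.rpow_natCast]
      exact Real.rpow_le_rpow_of_exponent_ge hs0 hs1.le
        (natCast_ceil_sub_one_le (mul_nonneg hK0.le h4))
    have hq := hsk.trans (s_pow_le_sum_subsetLaw_sq (c : ℝ) l)
    have hb : (n : ℝ) * c / 5 ≤ c * (n / 4 : ℕ) := by nlinarith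
    have hrate := min_mul_sqrt_le_collisionRate (subsetLaw_nonneg hy0 hy1)
      (sum_subsetLaw fun i => (1 - c : ℝ) ^ l i) (by positivity : 0 ≤ (c : ℝ) * (n / 4 : ℕ))
    have hr : a ^ 6 / n ≤ collisionRate (subsetLaw fun i => (1 - c : ℝ) ^ l i)
        (c * (n / 4 : ℕ)) := by
      refine le_trans (le_min ?_ (Real.le_sqrt_of_sq_le hq)) hrate
      refine le_trans ?_ (mul_le_mul hb hq (by positivity) (by positivity))
      have h8 : n * (c : ℝ) / 5 * (a ^ 6 / n) ^ 2 = a ^ 6 / n * (c * a ^ 6 / 5) := by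
        field_simp
      rw [h8]
      refine le_mul_of_one_le_right (by positivity) ?_
      rw [le_div_iff₀ (by norm_num)]
      have h9 : a ≤ a ^ 6 := le_self_pow₀ h3 (by norm_num)
      rw [div_le_iff₀ hc0] at h6
      nlinarith
    refine le_trans (le_of_eq ?_) (mul_le_mul hN5 hr (by positivity) (Nat.cast_nonneg _))
    field_simp

end Asymptotics

end SetColouring

theorem lemma4p3 (p : ℕ → unitInterval) (ε : ℝ) (hε : 0 < ε ∧ ε < 1)
    (hnp : Tendsto (fun n : ℕ => (n : ℝ) * (p n : ℝ)) atTop atTop)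
    (hlow : (fun n : ℕ => Real.log n ^ 2 * Real.log ((n : ℝ) * (p n : ℝ)) ^ 2 / (n : ℝ))
      =o[atTop] (fun n : ℕ => (p n : ℝ)))
    (hup : ∀ᶠ n : ℕ in atTop, (p n : ℝ) ≤ 1 - ε) :
    (Tendsto (fun n : ℕ => (p n : ℝ)) atTop (𝓝 0) →
      SetColouring.AAS p (fun n G =>
        SetColouring.rSparse n (p n) * Real.logb 2 n ≤ (SetColouring.setChromaticNumber G : ℝ))) ∧
    (∀ c : unitInterval, (∀ n : ℕ, p n = c) →
      ∃ η : ℕ → ℝ, Tendsto η atTop (𝓝 0) ∧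
        SetColouring.AAS p (fun n G =>
          (1 + η n) * SetColouring.rConst c * Real.logb 2 n
            ≤ (SetColouring.setChromaticNumber G : ℝ))) := by
  refine ⟨SetColouring.aas_sparse hnp hlow, fun c hc => ?_⟩
  obtain rfl : p = fun _ => c := funext hc
  obtain ⟨n, hn⟩ := (hnp.eventually_gt_atTop 0).exists
  obtain ⟨_, hn'⟩ := hup.exists
  exact SetColouring.aas_const (pos_of_mul_pos_right hn (Nat.cast_nonneg n))
    (by linarith [hε.1])
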